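/- Consider an open network of $J$ infinite server queues. Batches arrive at the points $T_1,T_2,\dots$ of a non-homogeneous Poisson process on $[0,\infty)$ with non-negative, locally integrable rate $\lambda$. The $i$-th batch brings $\Sigma_{ij}$ customers to queue $j$ ($1\le j\le J$), where the vectors $\mathbf\Sigma_i=(\Sigma_{i1},\dots,\Sigma_{iJ})$ are i.i.d. with values in $\mathbb Z_{\ge 0}^J$. The $\ell$-th customer of batch $i$ entering at queue $j$ is, at time $s\ge 0$ after arrival, in queue $X^j_{i,\ell}(s)\in\{1,\dots,J\}$, or has left the network; $X^j_{i,\ell}$ is a measurable stochastic process with $P(X^j_{i,\ell}(s)=k)=q^j_k(s)$. The arrival process, all the batches $\mathbf\Sigma_i$ and all the processes $X^j_{i,\ell}$ are mutually independent. For $t\ge 0$ let $\mathbf N(t)=(N_1(t),\dots,N_J(t))$, where $N_k(t)$ is the number of customers that arrived in $[0,t)$ and are in queue $k$ at time $t$, that is, $$N_k(t)=\sum_{i:\,T_i<t}\ \sum_{j=1}^J\sum_{\ell=1}^{\Sigma_{ij}}\mathbf 1\{X^j_{i,\ell}(t-T_i)=k\}.$$ Let $0<\rho<1$, let $p_1,\dots,p_J\ge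 0$ with $\sum_j p_j=1$, and suppose that the batches have the probability generating function $$E\Big[\prod_{j=1}^J z_j^{\Sigma_{ij}}\Big]=G_S\Big(\sum_{j=1}^J p_jz_j\Big)\qquad(|z_1|,\dots,|z_J|\le 1),$$ where $G_S(w)=E[w^S]$ and $S\sim\mathrm{Log}(\rho)$, i.e. $P(S=m)=-\frac{1}{\log(1-\rho)}\frac{\rho^m}{m}$ for $m\in\{1,2,\dots\}$ (a univariate logarithmic batch, each of whose customers independently chooses the entry queue $j$ with probability $p_j$). Put $q_k(s)=\sum_{j=1}^J p_j\,q^j_k(s)$. Then for every $t\ge 0$, every $v\in\{2,\dots,J\}$ and all integers $n_1,\dots,n_{v-1}\ge 0$, $n_v\ge 1$, $$\begin{aligned} P\big[\mathbf N(t)=(n_1,\dots,n_v,0,\dots,0)\big]=\sum_{i_1=0}^{n_1}\cdots\sum_{i_{v-1}=0}^{n_{v-1}}\sum_{i_v=1}^{n_v}\Bigg[&\frac{i_v}{n_v}\,P\big[\mathbf N(t)=(n_1-i_1,\dots,n_v-i_v,0,\dots,0)\big]\\ &\cdot\int_0^t-\lambda(\tau)\,\frac{\rho^{\sum_{k=1}^v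 i_k}}{\log(1-\rho)}\Big(\prod_{k=1}^v\frac{q_k(t-\tau)^{i_k}}{i_k!}\Big)\frac{\big(-1+\sum_{k=1}^v i_k\big)!}{\big[1-\rho\big(1-\sum_{k=1}^J q_k(t-\tau)\big)\big]^{\sum_{k=1}^v i_k}}\,d\tau\Bigg], \end{aligned}$$ where all the integrands are integrable on $[0,t]$. -/

import Mathlib

open MeasureTheory ProbabilityTheory Set
open scoped NNReal ENNReal Nat

namespace BatchQueue

variable {Ω : Type*} {J : ℕ}

/-- The mean measure `lam (τ) dτ` on `[0, ∞)` of a Poisson process with rate `lam`. -/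
noncomputable def intensity (lam : ℝ → ℝ) : Measure ℝ :=
  (volume.restrict (Ici (0 : ℝ))).withDensity fun τ => ENNReal.ofReal (lam τ)

/-- The number of arrival epochs that lie in `B`. The value `T i ω = ∞` means that there is no
`i`-th arrival (the total number of arrivals may be finite). -/
noncomputable def arrivalCount (T : ℕ → Ω → ℝ≥0∞) (B : Set ℝ) (ω : Ω) : ℕ∞ :=
  {i : ℕ | T i ω ≠ ∞ ∧ (T i ω).toReal ∈ B}.encard

/-- `T 0, T 1, …` are the points of a non-homogeneous Poisson process on `[0, ∞)` with rate
`lam`: the number of points in a Borel set of finite mean measure is Poisson distributed with that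
mean, and the numbers of points in disjoint Borel sets are independent. -/
structure IsPoissonProcess [MeasurableSpace Ω] (μ : Measure Ω) (lam : ℝ → ℝ)
    (T : ℕ → Ω → ℝ≥0∞) : Prop where
  measurable : ∀ i, Measurable (T i)
  poisson : ∀ B : Set ℝ, MeasurableSet B → intensity lam B ≠ ∞ → ∀ m : ℕ,
    μ.real {ω | arrivalCount T B ω = (m : ℕ∞)} =
      Real.exp (-(intensity lam B).toReal) * (intensity lam B).toReal ^ m / (m ! : ℝ)
  indep : ∀ (r : ℕ) (B : Fin r → Set ℝ), (∀ a, MeasurableSet (B a)) →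
    Pairwise (fun a b => Disjoint (B a) (B b)) →
    iIndepFun (fun a ω => arrivalCount T (B a) ω) μ

/-- The σ-algebra generated by a process `Y` with values in the queues `Fin J` or outside of the
network (`none`). -/
@[reducible] def routeSigma (Y : ℝ≥0 → Ω → Option (Fin J)) : MeasurableSpace Ω :=
  ⨆ s : ℝ≥0, MeasurableSpace.comap (Y s) ⊤

/-- The σ-algebras of the independent ingredients of the network: the arrival epochs, the batch
of each arrival, and the route of each customer. -/
@[reducible] def sourceSigma (T : ℕ → Ω → ℝ≥0∞) (S : ℕ → Fin J → Ω → ℕ)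
    (X : ℕ → Fin J → ℕ → ℝ≥0 → Ω → Option (Fin J)) :
    Unit ⊕ ℕ ⊕ (ℕ × Fin J × ℕ) → MeasurableSpace Ω :=
  Sum.elim (fun _ => ⨆ i, MeasurableSpace.comap (T i) inferInstance)
    (Sum.elim (fun i => ⨆ j, MeasurableSpace.comap (S i j) inferInstance)
      (fun c => routeSigma (X c.1 c.2.1 c.2.2)))

/-- An open network of `J` infinite server queues with multivariate batch arrivals.
* `T i` is the `i`-th arrival epoch, of a Poisson process with rate `lam`;
* `S i j` is the number of customers of batch `i` that enter the network at queue `j`;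
* `X i j l s` is the queue in which the `l`-th of these customers is located at time `s` after
  arrival (`none` once the customer has left the network), and `q j k s` is the probability that
  this is queue `k`. Each route is a measurable process, jointly in time and in its randomness
  (right-continuous paths suffice for this). -/
structure IsNetwork [MeasurableSpace Ω] (μ : Measure Ω) (lam : ℝ → ℝ)
    (q : Fin J → Fin J → ℝ → ℝ) (T : ℕ → Ω → ℝ≥0∞) (S : ℕ → Fin J → Ω → ℕ)
    (X : ℕ → Fin J → ℕ → ℝ≥0 → Ω → Option (Fin J)) : Prop where
  arrivals : IsPoissonProcess μ lam T
  batch_measurable : ∀ i j, Measurable (S i j)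
  batch_identDistrib : ∀ i, IdentDistrib (fun ω j => S i j ω) (fun ω j => S 0 j ω) μ μ
  route_measurable : ∀ i j l s k, MeasurableSet {ω | X i j l s ω = some k}
  route_jointly_measurable : ∀ i j l k,
    MeasurableSet[MeasurableSpace.prod inferInstance (routeSigma (X i j l))]
      {x : ℝ≥0 × Ω | X i j l x.1 x.2 = some k}
  route_law : ∀ i j l (s : ℝ≥0) k, μ.real {ω | X i j l s ω = some k} = q j k s
  independent : iIndep (sourceSigma T S X) μ

/-- The number of customers of batch `i` that are in queue `k` at time `s` after the arrival of
the batch. -/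
def batchOccupancy (S : ℕ → Fin J → Ω → ℕ) (X : ℕ → Fin J → ℕ → ℝ≥0 → Ω → Option (Fin J))
    (i : ℕ) (k : Fin J) (s : ℝ≥0) (ω : Ω) : ℕ :=
  ∑ j : Fin J, ∑ l ∈ Finset.range (S i j ω), if X i j l s ω = some k then 1 else 0

open Classical in
/-- The number `N_k(t)` of customers in queue `k` at time `t`, counting the batches that arrived
in `[0, t)`. -/
noncomputable def occupancy (T : ℕ → Ω → ℝ≥0∞) (S : ℕ → Fin J → Ω → ℕ)
    (X : ℕ → Fin J → ℕ → ℝ≥0 → Ω → Option (Fin J)) (t : ℝ≥0) (k : Fin J) (ω : Ω) : ℕ∞ :=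
  ∑' i : ℕ, if T i ω < (t : ℝ≥0∞) then
    (batchOccupancy S X i k (t - (T i ω).toNNReal) ω : ℕ∞) else 0

/-- The probability `P[N(t) = n]`. -/
noncomputable def occupancyProb [MeasurableSpace Ω] (μ : Measure Ω) (T : ℕ → Ω → ℝ≥0∞)
    (S : ℕ → Fin J → Ω → ℕ) (X : ℕ → Fin J → ℕ → ℝ≥0 → Ω → Option (Fin J)) (t : ℝ≥0)
    (n : Fin J → ℕ) : ℝ :=
  μ.real {ω | ∀ k, occupancy T S X t k ω = (n k : ℕ∞)}

/-- The probability mass function of the logarithmic distribution with parameter `ρ`. -/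
noncomputable def logPMF (ρ : ℝ) (m : ℕ) : ℝ :=
  if m = 0 then 0 else -(1 / Real.log (1 - ρ)) * (ρ ^ m / m)

/-- The probability generating function of the logarithmic distribution with parameter `ρ`. -/
noncomputable def logPGF (ρ : ℝ) (w : ℂ) : ℂ :=
  ∑' m : ℕ, (logPMF ρ m : ℂ) * w ^ m

/-- The multivariate probability generating function of the batch `S i`. -/
noncomputable def batchPGF [MeasurableSpace Ω] (μ : Measure Ω) (S : ℕ → Fin J → Ω → ℕ) (i : ℕ)
    (z : Fin J → ℂ) : ℂ :=
  ∫ ω, ∏ j, z j ^ S i j ω ∂μ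

/-- The probability that a customer is in queue `k` at time `s` after arrival, when the entry
queue is chosen with the probabilities `p`. -/
def mixedProb (p : Fin J → ℝ) (q : Fin J → Fin J → ℝ → ℝ) (k : Fin J) (s : ℝ) : ℝ :=
  ∑ j, p j * q j k s

/-- The integrand, as a function of the arrival epoch `τ`, of the recurrence for logarithmic
batches. -/
noncomputable def logKernel (ρ : ℝ) (lam : ℝ → ℝ) (p : Fin J → ℝ) (q : Fin J → Fin J → ℝ → ℝ)
    (t : ℝ) (v : Fin J) (i : Fin J → ℕ) (τ : ℝ) : ℝ :=
  -lam τ * (ρ ^ (∑ k ∈ Finset.Iic v, i k) / Real.log (1 - ρ)) *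
    (∏ k ∈ Finset.Iic v, mixedProb p q k (t - τ) ^ i k / ((i k)! : ℝ)) *
    (((∑ k ∈ Finset.Iic v, i k) - 1)! /
      (1 - ρ * (1 - ∑ k, mixedProb p q k (t - τ))) ^ (∑ k ∈ Finset.Iic v, i k))

end BatchQueue

namespace BatchQueue

section PowerSeries
open Filter Topology

theorem coeff_eq_zero_of_tsum_pow_eq_zero {a : ℕ → ℝ} (ha : Summable a)
    (h : ∀ x ∈ Icc (0 : ℝ) 1, ∑' m, a m * x ^ m = 0) (m : ℕ) : a m = 0 := by
  induction m using Nat.strong_induction_on with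
  | _ m ih =>
  have hshift : ∀ x ∈ Ioc (0 : ℝ) 1, ∑' r, a (r + m) * x ^ r = 0 := by
    intro x hx
    have hs : Summable fun r => a r * x ^ r := by
      refine Summable.of_norm_bounded ha.abs fun r => ?_
      rw [norm_mul, Real.norm_eq_abs, norm_pow, Real.norm_eq_abs, abs_of_pos hx.1]
      exact mul_le_of_le_one_right (abs_nonneg _) (pow_le_one₀ hx.1.le hx.2)
    have h1 := h x ⟨hx.1.le, hx.2⟩
    rw [← hs.sum_add_tsum_nat_add m, Finset.sum_eq_zero, zero_add] at h1
    · have h2 : ∑' r, a (r + m) * x ^ (r + m) = x ^ m * ∑' r, a (r + m) * x ^ r := by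
        rw [← tsum_mul_left]; congr 1; ext r; ring
      rw [h2] at h1
      exact (mul_eq_zero.mp h1).resolve_left (pow_pos hx.1 m).ne'
    · intro r hr
      rw [ih r (Finset.mem_range.mp hr), zero_mul]
  have hcont : ContinuousOn (fun x : ℝ => ∑' r, a (r + m) * x ^ r) (Icc 0 1) := by
    refine continuousOn_tsum (u := fun r => |a (r + m)|) (fun r => by fun_prop)
      ((summable_nat_add_iff m).mpr ha.abs) fun r x hx => ?_
    rw [norm_mul, Real.norm_eq_abs, norm_pow, Real.norm_eq_abs, abs_of_nonneg hx.1]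
    exact mul_le_of_le_one_right (abs_nonneg _) (pow_le_one₀ hx.1 hx.2)
  have h0 : Tendsto (fun x : ℝ => ∑' r, a (r + m) * x ^ r) (𝓝[>] 0)
      (𝓝 (∑' r, a (r + m) * 0 ^ r)) := by
    refine (hcont 0 (by simp)).mono_left ?_
    rw [← nhdsWithin_Ioc_eq_nhdsGT (zero_lt_one' ℝ)]
    exact nhdsWithin_mono _ Ioc_subset_Icc_self
  have h1 : Tendsto (fun x : ℝ => ∑' r, a (r + m) * x ^ r) (𝓝[>] 0) (𝓝 0) := by
    refine tendsto_const_nhds.congr' ?_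
    filter_upwards [Ioc_mem_nhdsGT (zero_lt_one' ℝ)] with x hx using (hshift x hx).symm
  have h2 := tendsto_nhds_unique h0 h1
  rw [tsum_eq_single 0 (by intro r hr; simp [hr])] at h2
  simpa using h2

/-- A summable family indexed by multi-indices is determined by its generating function on the
unit cube. -/
theorem eq_zero_of_tsum_monomial_eq_zero {J : ℕ} {a : (Fin J → ℕ) → ℝ} (ha : Summable a)
    (h : ∀ z : Fin J → ℝ, (∀ k, z k ∈ Icc (0 : ℝ) 1) → ∑' n, a n * ∏ k, z k ^ n k = 0)
    (n : Fin J → ℕ) : a n = 0 := by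
  induction J with
  | zero =>
    have := h 0 (fun k => k.elim0)
    rw [tsum_eq_single n (fun b hb => (hb (Subsingleton.elim _ _)).elim)] at this
    simpa using this
  | succ J ih =>
    let e := Fin.consEquiv (fun _ : Fin (J + 1) => ℕ)
    have hae : Summable fun x => a (e x) := (e.summable_iff (f := a)).mpr ha
    have key : ∀ m : ℕ, ∀ z : Fin J → ℝ, (∀ k, z k ∈ Icc (0 : ℝ) 1) →
        ∑' n', a (e (m, n')) * ∏ k, z k ^ n' k = 0 := by
      intro m z hz
      have hb : ∀ n' : Fin J → ℕ, ∏ k, z k ^ n' k ∈ Icc (0 : ℝ) 1 := fun n' =>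
        ⟨Finset.prod_nonneg fun k _ => pow_nonneg (hz k).1 _,
          Finset.prod_le_one (fun k _ => pow_nonneg (hz k).1 _)
            fun k _ => pow_le_one₀ (hz k).1 (hz k).2⟩
      have hs : Summable fun x : ℕ × (Fin J → ℕ) => a (e x) * ∏ k, z k ^ x.2 k := by
        refine Summable.of_norm_bounded hae.abs fun x => ?_
        rw [norm_mul, Real.norm_eq_abs, Real.norm_eq_abs, abs_of_nonneg (hb x.2).1]
        exact mul_le_of_le_one_right (abs_nonneg _) (hb x.2).2
      refine coeff_eq_zero_of_tsum_pow_eq_zero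
        (a := fun m => ∑' n', a (e (m, n')) * ∏ k, z k ^ n' k) hs.prod (fun x hx => ?_) m
      rw [← h (Fin.cons x z) (fun k => by
        refine Fin.cases ?_ (fun k => ?_) k
        · simpa using hx
        · simpa using hz k), ← e.tsum_eq (fun n => a n * ∏ k, (Fin.cons x z : Fin (J+1) → ℝ) k ^ n k)]
      have he : ∀ y : ℕ × (Fin J → ℕ),
          ∏ k, (Fin.cons x z : Fin (J+1) → ℝ) k ^ e y k = x ^ y.1 * ∏ k, z k ^ y.2 k := by
        intro y
        rw [Fin.prod_univ_succ]
        simp [e, Fin.consEquiv]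
      simp_rw [he]
      have hs' : Summable fun y : ℕ × (Fin J → ℕ) => a (e y) * (x ^ y.1 * ∏ k, z k ^ y.2 k) := by
        refine Summable.of_norm_bounded hs.abs fun y => ?_
        rw [show a (e y) * (x ^ y.1 * ∏ k, z k ^ y.2 k) = x ^ y.1 * (a (e y) * ∏ k, z k ^ y.2 k) by
          ring, norm_mul, Real.norm_eq_abs, Real.norm_eq_abs, abs_of_nonneg (pow_nonneg hx.1 _)]
        exact mul_le_of_le_one_left (abs_nonneg _) (pow_le_one₀ hx.1 hx.2)
      rw [hs'.tsum_prod]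
      congr 1; ext m
      rw [← tsum_mul_right]
      congr 1; ext n'; ring
    obtain ⟨y, rfl⟩ := e.surjective n
    exact ih (a := fun n' => a (e (y.1, n')))
      (hae.comp_injective (i := fun n' => (y.1, n')) (Prod.mk_right_injective _)) (key y.1) y.2

variable {σ : Type*}

/-- The Euler operator `X_v ∂/∂X_v` on multivariate power series. -/
noncomputable def eulerOp (v : σ) (f : MvPowerSeries σ ℝ) : MvPowerSeries σ ℝ :=
  fun n => (n v : ℝ) * MvPowerSeries.coeff n f

theorem coeff_eulerOp (v : σ) (f : MvPowerSeries σ ℝ) (n : σ →₀ ℕ) :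
    MvPowerSeries.coeff n (eulerOp v f) = (n v : ℝ) * MvPowerSeries.coeff n f := rfl

theorem eulerOp_mul (v : σ) (f g : MvPowerSeries σ ℝ) :
    eulerOp v (f * g) = eulerOp v f * g + f * eulerOp v g := by
  classical
  ext n
  rw [coeff_eulerOp, map_add, MvPowerSeries.coeff_mul, MvPowerSeries.coeff_mul,
    MvPowerSeries.coeff_mul, Finset.mul_sum, ← Finset.sum_add_distrib]
  refine Finset.sum_congr rfl fun x hx => ?_
  rw [Finset.HasAntidiagonal.mem_antidiagonal] at hx
  rw [coeff_eulerOp, coeff_eulerOp, ← hx, Finsupp.add_apply, Nat.cast_add]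
  ring

theorem eulerOp_one (v : σ) : eulerOp v 1 = 0 := by
  classical
  ext n
  rw [coeff_eulerOp, MvPowerSeries.coeff_one]
  split_ifs with h <;> simp [h]

theorem eulerOp_pow_succ (v : σ) (f : MvPowerSeries σ ℝ) (m : ℕ) :
    eulerOp v (f ^ (m + 1)) = (m + 1 : ℝ) • (eulerOp v f * f ^ m) := by
  induction m with
  | zero => simp
  | succ m ih =>
    rw [pow_succ, eulerOp_mul, ih, Nat.cast_succ, pow_succ]
    simp only [MvPowerSeries.smul_eq_C_mul, map_add, map_one]
    ring

theorem coeff_pow_nonneg {c : MvPowerSeries σ ℝ} (hc : ∀ n, 0 ≤ MvPowerSeries.coeff n c) (m : ℕ)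
    (n : σ →₀ ℕ) : 0 ≤ MvPowerSeries.coeff n (c ^ m) := by
  classical
  induction m generalizing n with
  | zero => rw [pow_zero, MvPowerSeries.coeff_one]; split_ifs <;> norm_num
  | succ m ih =>
    rw [pow_succ, MvPowerSeries.coeff_mul]
    exact Finset.sum_nonneg fun x _ => mul_nonneg (ih _) (hc _)

section Evaluation
variable [Fintype σ]

theorem prod_pow_mem_Icc {z : σ → ℝ} (hz : ∀ k, z k ∈ Icc (0 : ℝ) 1) (n : σ → ℕ) :
    ∏ k, z k ^ n k ∈ Icc (0 : ℝ) 1 :=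
  ⟨Finset.prod_nonneg fun k _ => pow_nonneg (hz k).1 _,
    Finset.prod_le_one (fun k _ => pow_nonneg (hz k).1 _)
      fun k _ => pow_le_one₀ (hz k).1 (hz k).2⟩

theorem hasSum_coeff_pow {c : MvPowerSeries σ ℝ} (hc : ∀ n, 0 ≤ MvPowerSeries.coeff n c)
    {z : σ → ℝ} (hz : ∀ k, 0 ≤ z k) {h : ℝ}
    (hh : HasSum (fun n : σ →₀ ℕ => MvPowerSeries.coeff n c * ∏ k, z k ^ n k) h) (m : ℕ) :
    HasSum (fun n : σ →₀ ℕ => MvPowerSeries.coeff n (c ^ m) * ∏ k, z k ^ n k) (h ^ m) := by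
  classical
  have hz' : ∀ n : σ →₀ ℕ, 0 ≤ ∏ k, z k ^ n k := fun n =>
    Finset.prod_nonneg fun k _ => pow_nonneg (hz k) _
  induction m with
  | zero =>
    rw [pow_zero, pow_zero]
    convert hasSum_single (0 : σ →₀ ℕ) _ using 1
    · simp
    · intro n hn
      rw [MvPowerSeries.coeff_one, if_neg hn, zero_mul]
  | succ m ih =>
    have hs := Summable.mul_of_nonneg ih.summable hh.summable
      (fun n => mul_nonneg (coeff_pow_nonneg hc m n) (hz' n))
      (fun n => mul_nonneg (hc n) (hz' n))
    have key : ∀ n : σ →₀ ℕ, ∑ x ∈ Finset.HasAntidiagonal.antidiagonal n,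
        (MvPowerSeries.coeff x.1 (c ^ m) * ∏ k, z k ^ x.1 k) *
          (MvPowerSeries.coeff x.2 c * ∏ k, z k ^ x.2 k) =
        MvPowerSeries.coeff n (c ^ (m + 1)) * ∏ k, z k ^ n k := by
      intro n
      rw [pow_succ, MvPowerSeries.coeff_mul, Finset.sum_mul]
      refine Finset.sum_congr rfl fun x hx => ?_
      rw [Finset.HasAntidiagonal.mem_antidiagonal] at hx
      have : ∏ k, z k ^ n k = (∏ k, z k ^ x.1 k) * ∏ k, z k ^ x.2 k := by
        rw [← Finset.prod_mul_distrib, ← hx]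
        exact Finset.prod_congr rfl fun k _ => by rw [Finsupp.add_apply, pow_add]
      rw [this]; ring
    have h1 := Summable.tsum_mul_tsum_eq_tsum_sum_antidiagonal ih.summable hh.summable hs
    have h2 := (summable_sum_mul_antidiagonal_of_summable_mul
      (f := fun n : σ →₀ ℕ => MvPowerSeries.coeff n (c ^ m) * ∏ k, z k ^ n k)
      (g := fun n : σ →₀ ℕ => MvPowerSeries.coeff n c * ∏ k, z k ^ n k) hs).hasSum
    rw [← h1, ih.tsum_eq, hh.tsum_eq] at h2
    simp_rw [key] at h2
    rwa [pow_succ]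

/-- The compound Poisson probability mass function with jump intensities `c`. -/
noncomputable def compoundPoisson (c : MvPowerSeries σ ℝ) (n : σ →₀ ℕ) : ℝ :=
  Real.exp (-∑' i : σ →₀ ℕ, MvPowerSeries.coeff i c) *
    ∑' m : ℕ, MvPowerSeries.coeff n (c ^ m) / (m ! : ℝ)

theorem summable_coeff_pow_div_factorial {c : MvPowerSeries σ ℝ}
    (hc : ∀ n, 0 ≤ MvPowerSeries.coeff n c)
    (hs : Summable fun n : σ →₀ ℕ => MvPowerSeries.coeff n c) (n : σ →₀ ℕ) :
    Summable fun m : ℕ => MvPowerSeries.coeff n (c ^ m) / (m ! : ℝ) := by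
  refine Summable.of_nonneg_of_le (fun m => div_nonneg (coeff_pow_nonneg hc m n) (by positivity))
    (fun m => ?_) (Real.summable_pow_div_factorial (∑' i : σ →₀ ℕ, MvPowerSeries.coeff i c))
  gcongr
  have h := hasSum_coeff_pow hc (z := fun _ => 1) (fun _ => zero_le_one) (by simpa using hs.hasSum) m
  simpa using le_hasSum h n fun j _ => by simpa using coeff_pow_nonneg hc m j

theorem hasSum_compoundPoisson {c : MvPowerSeries σ ℝ} (hc : ∀ n, 0 ≤ MvPowerSeries.coeff n c)
    {z : σ → ℝ} (hz : ∀ k, 0 ≤ z k) {h : ℝ}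
    (hh : HasSum (fun n : σ →₀ ℕ => MvPowerSeries.coeff n c * ∏ k, z k ^ n k) h) :
    HasSum (fun n : σ →₀ ℕ => compoundPoisson c n * ∏ k, z k ^ n k)
      (Real.exp (h - ∑' i : σ →₀ ℕ, MvPowerSeries.coeff i c)) := by
  have hz' : ∀ n : σ →₀ ℕ, 0 ≤ ∏ k, z k ^ n k := fun n =>
    Finset.prod_nonneg fun k _ => pow_nonneg (hz k) _
  let F : ℕ × (σ →₀ ℕ) → ℝ := fun x =>
    MvPowerSeries.coeff x.2 (c ^ x.1) * (∏ k, z k ^ x.2 k) / (x.1 ! : ℝ)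
  have h1 : ∀ m, HasSum (fun n => F (m, n)) (h ^ m / (m ! : ℝ)) := fun m =>
    (hasSum_coeff_pow hc hz hh m).div_const _
  have h2 : HasSum (fun m : ℕ => h ^ m / (m ! : ℝ)) (Real.exp h) := by
    rw [Real.exp_eq_exp_ℝ]; exact NormedSpace.expSeries_div_hasSum_exp h
  have hF : Summable F := by
    refine (summable_prod_of_nonneg fun x => ?_).mpr ⟨fun m => (h1 m).summable, ?_⟩
    · exact div_nonneg (mul_nonneg (coeff_pow_nonneg hc _ _) (hz' _)) (by positivity)
    · simpa only [fun m => (h1 m).tsum_eq] using h2.summable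
  have h3 : HasSum F (Real.exp h) := by
    have := hF.hasSum.prod_fiberwise h1
    rw [← this.unique h2]; exact hF.hasSum
  have h4 := ((Equiv.prodComm _ _).hasSum_iff.mpr h3).prod_fiberwise
    (g := fun n => ∑' m, F (m, n))
    (fun n => (hF.comp_injective (i := fun m => (m, n)) (Prod.mk_left_injective n)).hasSum)
  have h5 := h4.mul_left (Real.exp (-∑' i : σ →₀ ℕ, MvPowerSeries.coeff i c))
  rw [← Real.exp_add, neg_add_eq_sub] at h5
  refine (congrArg (fun f => HasSum f _ _) (funext fun n => ?_)).mpr h5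
  rw [compoundPoisson, mul_assoc, ← tsum_mul_right]
  congr 2; ext m
  simp only [F]; ring

/-- The Panjer recursion for the compound Poisson distribution. -/
theorem compoundPoisson_recurrence [DecidableEq σ] {c : MvPowerSeries σ ℝ}
    (hc : ∀ n, 0 ≤ MvPowerSeries.coeff n c)
    (hs : Summable fun n : σ →₀ ℕ => MvPowerSeries.coeff n c) (v : σ) (n : σ →₀ ℕ) :
    (n v : ℝ) * compoundPoisson c n = ∑ x ∈ Finset.HasAntidiagonal.antidiagonal n,
      (x.1 v : ℝ) * MvPowerSeries.coeff x.1 c * compoundPoisson c x.2 := by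
  have hsum := summable_coeff_pow_div_factorial hc hs
  have h0 : (n v : ℝ) * MvPowerSeries.coeff n (1 : MvPowerSeries σ ℝ) = 0 := by
    rw [← coeff_eulerOp, eulerOp_one, map_zero]
  have h1 : ∀ m : ℕ, (n v : ℝ) * (MvPowerSeries.coeff n (c ^ (m + 1)) / ((m + 1)! : ℝ)) =
      ∑ x ∈ Finset.HasAntidiagonal.antidiagonal n, (x.1 v : ℝ) * MvPowerSeries.coeff x.1 c *
        (MvPowerSeries.coeff x.2 (c ^ m) / (m ! : ℝ)) := by
    intro m
    rw [← mul_div_assoc, ← coeff_eulerOp, eulerOp_pow_succ, map_smul, MvPowerSeries.coeff_mul,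
      Nat.factorial_succ, Nat.cast_mul, Nat.cast_succ, smul_eq_mul, mul_div_mul_left _ _ (by positivity),
      Finset.sum_div]
    exact Finset.sum_congr rfl fun x _ => by rw [coeff_eulerOp]; ring
  have h2 : (n v : ℝ) * ∑' m : ℕ, MvPowerSeries.coeff n (c ^ m) / (m ! : ℝ) =
      ∑ x ∈ Finset.HasAntidiagonal.antidiagonal n, (x.1 v : ℝ) * MvPowerSeries.coeff x.1 c *
        ∑' m : ℕ, MvPowerSeries.coeff x.2 (c ^ m) / (m ! : ℝ) := by
    have h3 : ∀ x : (σ →₀ ℕ) × (σ →₀ ℕ), Summable fun m : ℕ =>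
        (x.1 v : ℝ) * MvPowerSeries.coeff x.1 c * (MvPowerSeries.coeff x.2 (c ^ m) / (m ! : ℝ)) :=
      fun x => (hsum x.2).mul_left _
    rw [(hsum n).tsum_eq_zero_add, mul_add, pow_zero, ← mul_div_assoc, h0, zero_div, zero_add,
      ← tsum_mul_left, tsum_congr h1, Summable.tsum_finsetSum fun x _ => h3 x]
    exact Finset.sum_congr rfl fun x _ => tsum_mul_left
  rw [compoundPoisson, mul_left_comm, h2, Finset.mul_sum]
  exact Finset.sum_congr rfl fun x _ => by rw [compoundPoisson]; ring

end Evaluation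
end PowerSeries

section LogSeries

theorem hasSum_pow_div_nat {y : ℝ} (hy : |y| < 1) :
    HasSum (fun m : ℕ => y ^ m / (m : ℝ)) (-Real.log (1 - y)) := by
  have h := Real.hasSum_pow_div_log_of_abs_lt_one hy
  refine (hasSum_nat_add_iff' 1).mp ?_
  simpa using h

theorem logPGF_ofReal {ρ x : ℝ} (hρ₀ : 0 < ρ) (hρ₁ : ρ < 1) (hx : x ∈ Icc (0 : ℝ) 1) :
    logPGF ρ (x : ℂ) = ((Real.log (1 - ρ * x) / Real.log (1 - ρ) : ℝ) : ℂ) := by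
  have hy : |ρ * x| < 1 := by
    rw [abs_of_nonneg (mul_nonneg hρ₀.le hx.1)]
    nlinarith [hx.1, hx.2]
  have h := (hasSum_pow_div_nat hy).mul_left (-(1 / Real.log (1 - ρ)))
  have h2 : (fun m : ℕ => (logPMF ρ m : ℂ) * (x : ℂ) ^ m) =
      fun m : ℕ => ((-(1 / Real.log (1 - ρ)) * ((ρ * x) ^ m / (m : ℝ)) : ℝ) : ℂ) := by
    ext m
    rw [logPMF]
    split_ifs with hm
    · simp [hm]
    · push_cast; rw [mul_pow]; ring
  rw [logPGF, h2, ← Complex.ofReal_tsum, h.tsum_eq]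
  congr 1; ring

/-- The intensity with which logarithmic batches bring `i k` customers to each queue `k`, when a
customer is in queue `k` with probability `q k`; empty contributions are discarded. -/
noncomputable def logJump {J : ℕ} (ρ : ℝ) (q : Fin J → ℝ) (i : Fin J → ℕ) : ℝ :=
  if i = 0 then 0 else
    -(ρ ^ (∑ k, i k) / Real.log (1 - ρ)) * (∏ k, q k ^ i k / ((i k)! : ℝ)) *
      (((∑ k, i k) - 1)! / (1 - ρ * (1 - ∑ k, q k)) ^ (∑ k, i k))

variable {J : ℕ} {ρ : ℝ} {q : Fin J → ℝ}

theorem logJump_nonneg (hρ₀ : 0 < ρ) (hρ₁ : ρ < 1) (hq : ∀ k, 0 ≤ q k) (i : Fin J → ℕ) :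
    0 ≤ logJump ρ q i := by
  unfold logJump
  split_ifs with h
  · rfl
  · have hQ : 0 ≤ ∑ k, q k := Finset.sum_nonneg fun k _ => hq k
    have hd : 0 ≤ 1 - ρ * (1 - ∑ k, q k) := by nlinarith
    have hL : Real.log (1 - ρ) ≤ 0 := Real.log_nonpos (by linarith) (by linarith)
    have h1 : 0 ≤ -(ρ ^ (∑ k, i k) / Real.log (1 - ρ)) := by
      rw [neg_nonneg]; exact div_nonpos_of_nonneg_of_nonpos (by positivity) hL
    have h2 : 0 ≤ ∏ k, q k ^ i k / ((i k)! : ℝ) :=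
      Finset.prod_nonneg fun k _ => div_nonneg (pow_nonneg (hq k) _) (by positivity)
    positivity

theorem sum_logJump_fiber (hd : 1 - ρ * (1 - ∑ k, q k) ≠ 0) (z : Fin J → ℝ) (m : ℕ) :
    ∑ i ∈ Finset.univ.piAntidiag m, logJump ρ q i * ∏ k, z k ^ i k =
      -(1 / Real.log (1 - ρ)) *
        ((ρ * (∑ k, q k * z k) / (1 - ρ * (1 - ∑ k, q k))) ^ m / (m : ℝ)) := by
  rcases Nat.eq_zero_or_pos m with rfl | hm
  · simp [logJump]
  rw [div_pow, mul_pow, Finset.sum_pow_eq_sum_piAntidiag, Finset.mul_sum, Finset.sum_div,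
    Finset.sum_div, Finset.mul_sum]
  refine Finset.sum_congr rfl fun i hi => ?_
  have hi' : ∑ k, i k = m := (Finset.mem_piAntidiag.mp hi).1
  have hi0 : i ≠ 0 := by rintro rfl; simp at hi'; omega
  have hmul : (Nat.multinomial Finset.univ i : ℝ) * ∏ k, ((i k)! : ℝ) = m * ((m - 1)! : ℝ) := by
    have h := Nat.multinomial_spec Finset.univ i
    rw [hi', ← Nat.mul_factorial_pred hm.ne'] at h
    rw [mul_comm]; exact_mod_cast h
  have hprod : (∏ k, ((i k)! : ℝ)) ≠ 0 := Finset.prod_ne_zero_iff.mpr fun k _ => by positivity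
  have hmul' : (Nat.multinomial Finset.univ i : ℝ) = m * ((m - 1)! : ℝ) / ∏ k, ((i k)! : ℝ) := by
    rw [← hmul, mul_div_assoc, div_self hprod, mul_one]
  have hm' : (m : ℝ) ≠ 0 := by positivity
  rw [logJump, if_neg hi0, hi', hmul', Finset.prod_div_distrib]
  simp_rw [mul_pow]
  rw [Finset.prod_mul_distrib]
  field_simp

/-- A nonnegative family indexed by multi-indices can be summed degree by degree. -/
theorem hasSum_of_sum_piAntidiag {f : (Fin J → ℕ) → ℝ} (hf : ∀ i, 0 ≤ f i) {g : ℕ → ℝ}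
    (hfg : ∀ m, ∑ i ∈ Finset.univ.piAntidiag m, f i = g m) {a : ℝ} (hg : HasSum g a) :
    HasSum f a := by
  let e := Equiv.sigmaFiberEquiv (fun i : Fin J → ℕ => ∑ k, i k)
  have hfib : ∀ m : ℕ, HasSum (fun i : {i : Fin J → ℕ // ∑ k, i k = m} => f i) (g m) := by
    intro m
    refine (hasSum_subtype_iff_indicator (s := {i : Fin J → ℕ | ∑ k, i k = m}) (f := f)).mpr ?_
    have : g m = ∑ i ∈ Finset.univ.piAntidiag m, {i : Fin J → ℕ | ∑ k, i k = m}.indicator f i := by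
      rw [← hfg m]
      refine Finset.sum_congr rfl fun i hi => ?_
      rw [indicator_of_mem]
      exact (Finset.mem_piAntidiag.mp hi).1
    rw [this]
    refine hasSum_sum_of_ne_finset_zero fun i hi => indicator_of_notMem (fun h => hi ?_) _
    exact Finset.mem_piAntidiag.mpr ⟨h, fun _ _ => Finset.mem_univ _⟩
  have hs : Summable (f ∘ e) := by
    refine (summable_sigma_of_nonneg fun x => hf _).mpr ⟨fun m => (hfib m).summable, ?_⟩
    exact hg.summable.congr fun m => (hfib m).tsum_eq.symm
  exact e.hasSum_iff.mp (HasSum.sigma_of_hasSum hg hfib hs)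

theorem hasSum_logJump (hρ₀ : 0 < ρ) (hρ₁ : ρ < 1) (hq : ∀ k, 0 ≤ q k)
    {z : Fin J → ℝ} (hz : ∀ k, z k ∈ Icc (0 : ℝ) 1) :
    HasSum (fun i : Fin J → ℕ => logJump ρ q i * ∏ k, z k ^ i k)
      (Real.log (1 - ρ * (1 - ∑ k, q k + ∑ k, q k * z k)) / Real.log (1 - ρ) -
        Real.log (1 - ρ * (1 - ∑ k, q k)) / Real.log (1 - ρ)) := by
  have hQ : 0 ≤ ∑ k, q k := Finset.sum_nonneg fun k _ => hq k
  have hd : 0 < 1 - ρ * (1 - ∑ k, q k) := by nlinarith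
  have hqz₀ : 0 ≤ ∑ k, q k * z k := Finset.sum_nonneg fun k _ => mul_nonneg (hq k) (hz k).1
  have hqz₁ : ∑ k, q k * z k ≤ ∑ k, q k :=
    Finset.sum_le_sum fun k _ => mul_le_of_le_one_right (hq k) (hz k).2
  have hn : 0 < 1 - ρ * (1 - ∑ k, q k + ∑ k, q k * z k) := by nlinarith
  set y := ρ * (∑ k, q k * z k) / (1 - ρ * (1 - ∑ k, q k)) with hy
  have hy1 : 1 - y = (1 - ρ * (1 - ∑ k, q k + ∑ k, q k * z k)) / (1 - ρ * (1 - ∑ k, q k)) := by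
    rw [hy]; field_simp; ring
  have hyabs : |y| < 1 := by
    have h1 : 0 < 1 - y := by rw [hy1]; positivity
    have h2 : 0 ≤ y := by rw [hy]; positivity
    rw [abs_of_nonneg h2]; linarith
  have hsum := (hasSum_pow_div_nat hyabs).mul_left (-(1 / Real.log (1 - ρ)))
  have h := hasSum_of_sum_piAntidiag (fun i => mul_nonneg (logJump_nonneg hρ₀ hρ₁ hq i)
    (prod_pow_mem_Icc hz i).1) (sum_logJump_fiber hd.ne' z) hsum
  convert h using 1
  rw [hy1, Real.log_div hn.ne' hd.ne']
  ring

end LogSeries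

section Laplace
open Filter Topology

variable {Ω : Type*} {T : ℕ → Ω → ℝ≥0∞} {A : Set ℝ}

/-- The value `G x` at the points `x` of `A`, and `1` elsewhere. -/
noncomputable def pointVal (A : Set ℝ) (G : ℝ → ℝ) (x : ℝ≥0∞) : ℝ :=
  open Classical in if x ≠ ∞ ∧ x.toReal ∈ A then G x.toReal else 1

theorem pointVal_mem_Icc {G : ℝ → ℝ} (hG : ∀ x, G x ∈ Icc (0 : ℝ) 1) (x : ℝ≥0∞) :
    pointVal A G x ∈ Icc (0 : ℝ) 1 := by
  unfold pointVal; split_ifs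
  · exact hG _
  · simp

theorem measurableSet_point (hA : MeasurableSet A) :
    MeasurableSet {x : ℝ≥0∞ | x ≠ ∞ ∧ x.toReal ∈ A} :=
  (measurableSet_singleton _).compl.inter (ENNReal.measurable_toReal hA)

theorem measurable_pointVal (hA : MeasurableSet A) {G : ℝ → ℝ} (hG : Measurable G) :
    Measurable (pointVal A G) := by
  classical
  unfold pointVal
  refine Measurable.ite ?_ (hG.comp ENNReal.measurable_toReal) measurable_const
  exact measurableSet_point hA

theorem tendsto_prod_range_finprod {u : ℕ → ℝ} {I : Set ℕ} (hI : I.Finite)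
    (hu : ∀ i, i ∉ I → u i = 1) :
    Tendsto (fun m => ∏ i ∈ Finset.range m, u i) atTop (𝓝 (∏ᶠ i, u i)) := by
  obtain ⟨M, hM⟩ := hI.bddAbove
  refine tendsto_const_nhds.congr' ?_
  filter_upwards [eventually_gt_atTop M] with m hm
  refine finprod_eq_prod_of_mulSupport_subset u fun i hi => ?_
  have : i ∈ I := by by_contra h; exact hi (hu i h)
  simpa using (hM this).trans_lt hm

/-- The power `c ^ x`, with the value `0` at `x = ∞`. -/
noncomputable def powENat (c : ℝ) (x : ℕ∞) : ℝ :=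
  open Classical in if x = ⊤ then 0 else c ^ x.toNat

theorem powENat_natCast (c : ℝ) (m : ℕ) : powENat c m = c ^ m := by simp [powENat]

theorem abs_powENat_le {c : ℝ} (hc : c ∈ Icc (0 : ℝ) 1) (x : ℕ∞) : |powENat c x| ≤ 1 := by
  unfold powENat; split_ifs
  · simp
  · rw [abs_of_nonneg (pow_nonneg hc.1 _)]; exact pow_le_one₀ hc.1 hc.2

theorem measurable_arrivalCount [MeasurableSpace Ω] (hT : ∀ i, Measurable (T i))
    (hA : MeasurableSet A) : Measurable (arrivalCount T A) := by
  have hle : ∀ m : ℕ, MeasurableSet {ω | (m : ℕ∞) ≤ arrivalCount T A ω} := by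
    intro m
    have : {ω | (m : ℕ∞) ≤ arrivalCount T A ω} =
        ⋃ F : {F : Finset ℕ // F.card = m}, ⋂ i ∈ F.1, {ω | T i ω ≠ ∞ ∧ (T i ω).toReal ∈ A} := by
      ext ω
      simp only [mem_ofPred_eq, mem_iUnion, mem_iInter, arrivalCount]
      constructor
      · intro h
        obtain ⟨t, ht, htm⟩ := Set.exists_subset_encard_eq h
        have hfin : t.Finite := Set.finite_of_encard_eq_coe htm
        refine ⟨⟨hfin.toFinset, ?_⟩, fun i hi => ht (hfin.mem_toFinset.mp hi)⟩
        rw [hfin.encard_eq_coe_toFinset_card] at htm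
        exact_mod_cast htm
      · rintro ⟨F, hF⟩
        rw [← F.2, ← Set.encard_coe_eq_coe_finsetCard]
        exact Set.encard_le_encard fun i hi => hF i hi
    rw [this]
    exact MeasurableSet.iUnion fun F => Finset.measurableSet_biInter _ fun i _ =>
      hT i (measurableSet_point hA)
  refine measurable_to_countable' fun x => ?_
  induction x using ENat.recTopCoe with
  | top =>
    have : arrivalCount T A ⁻¹' {⊤} = ⋂ m : ℕ, {ω | (m : ℕ∞) ≤ arrivalCount T A ω} := by
      ext ω; simp [ENat.eq_top_iff_forall_ge]
    rw [this]; exact MeasurableSet.iInter hle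
  | coe m =>
    have : arrivalCount T A ⁻¹' {(m : ℕ∞)} = {ω | (m : ℕ∞) ≤ arrivalCount T A ω} \
        {ω | ((m + 1 : ℕ) : ℕ∞) ≤ arrivalCount T A ω} := by
      ext ω
      simp only [mem_preimage, mem_singleton_iff, Set.mem_sdiff, mem_ofPred_eq, Nat.cast_add, Nat.cast_one,
        ENat.add_one_le_iff (ENat.natCast_ne_top m), not_lt]
      exact ⟨fun h => ⟨h.ge, h.le⟩, fun h => le_antisymm h.2 h.1⟩
    rw [this]; exact (hle m).diff (hle (m + 1))

theorem finprod_pointVal_eq_prod {ω : Ω} (hI : {i | T i ω ≠ ∞ ∧ (T i ω).toReal ∈ A}.Finite)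
    (G : ℝ → ℝ) : ∏ᶠ i, pointVal A G (T i ω) = ∏ i ∈ hI.toFinset, G (T i ω).toReal := by
  rw [finprod_eq_prod_of_mulSupport_subset _ (s := hI.toFinset)]
  · refine Finset.prod_congr rfl fun i hi => ?_
    exact if_pos (by simpa using hi)
  · intro i hi
    by_contra h
    exact hi (if_neg (by simpa using h))

theorem norm_prod_le_one {ι : Type*} {s : Finset ι} {u : ι → ℝ} (hu : ∀ i, u i ∈ Icc (0 : ℝ) 1) :
    ‖∏ i ∈ s, u i‖ ≤ 1 := by
  rw [Real.norm_eq_abs, abs_of_nonneg (Finset.prod_nonneg fun i _ => (hu i).1)]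
  exact Finset.prod_le_one (fun i _ => (hu i).1) fun i _ => (hu i).2

theorem finprod_pointVal_simpleFunc {ω : Ω}
    (hI : {i | T i ω ≠ ∞ ∧ (T i ω).toReal ∈ A}.Finite) (f : SimpleFunc ℝ ℝ) :
    ∏ᶠ i, pointVal A f (T i ω) =
      ∏ c ∈ f.range, powENat c (arrivalCount T (A ∩ f ⁻¹' {c}) ω) := by
  classical
  rw [finprod_pointVal_eq_prod hI,
    ← Finset.prod_fiberwise_of_maps_to (t := f.range) (g := fun i => f (T i ω).toReal)
      fun i _ => f.mem_range_self _]
  refine Finset.prod_congr rfl fun c _ => ?_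
  have hcount : arrivalCount T (A ∩ f ⁻¹' {c}) ω =
      ((hI.toFinset.filter fun i => f (T i ω).toReal = c).card : ℕ∞) := by
    rw [← Set.encard_coe_eq_coe_finsetCard, arrivalCount]
    congr 1; ext i; simp [and_assoc]
  rw [hcount, powENat_natCast]
  exact Finset.prod_eq_pow_card fun i hi => (Finset.mem_filter.mp hi).2

variable [MeasurableSpace Ω] {μ : Measure Ω} [IsProbabilityMeasure μ] {lam : ℝ → ℝ}

theorem IsPoissonProcess.integral_powENat (h : IsPoissonProcess μ lam T) (hA : MeasurableSet A)
    (hfin : intensity lam A ≠ ∞) {c : ℝ} (hc : c ∈ Icc (0 : ℝ) 1) :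
    ∫ ω, powENat c (arrivalCount T A ω) ∂μ = Real.exp ((intensity lam A).toReal * (c - 1)) := by
  have hK := measurable_arrivalCount h.measurable hA
  have hm : Measurable (powENat c) := .of_discrete
  have : IsProbabilityMeasure (μ.map (arrivalCount T A)) :=
    Measure.isProbabilityMeasure_map hK.aemeasurable
  rw [← integral_map (f := powENat c) hK.aemeasurable hm.aestronglyMeasurable, integral_countable,
    ← Nat.cast_injective.tsum_eq (g := fun m : ℕ => (m : ℕ∞))]
  · have hterm : ∀ m : ℕ, (μ.map (arrivalCount T A)).real {(m : ℕ∞)} • powENat c m =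
        Real.exp (-(intensity lam A).toReal) * (((intensity lam A).toReal * c) ^ m / (m ! : ℝ)) := by
      intro m
      rw [map_measureReal_apply hK (measurableSet_singleton _), powENat_natCast, smul_eq_mul]
      have := h.poisson A hA hfin m
      change μ.real {ω | arrivalCount T A ω = (m : ℕ∞)} * _ = _
      rw [this, mul_pow]; ring
    simp_rw [hterm]
    rw [tsum_mul_left, (NormedSpace.expSeries_div_hasSum_exp _).tsum_eq, ← Real.exp_eq_exp_ℝ,
      ← Real.exp_add]
    congr 1; ring
  · intro x hx
    induction x using ENat.recTopCoe with
    | top => simp [powENat] at hx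
    | coe m => exact ⟨m, rfl⟩
  · refine Integrable.of_bound hm.aestronglyMeasurable 1 (ae_of_all _ fun x => ?_)
    exact abs_powENat_le hc x

theorem IsPoissonProcess.ae_finite (h : IsPoissonProcess μ lam T) (hA : MeasurableSet A)
    (hfin : intensity lam A ≠ ∞) : ∀ᵐ ω ∂μ, {i | T i ω ≠ ∞ ∧ (T i ω).toReal ∈ A}.Finite := by
  have hK := measurable_arrivalCount h.measurable hA
  have h1 := h.integral_powENat hA hfin (c := 1) (by simp)
  have hpow : ∀ ω, powENat 1 (arrivalCount T A ω) =
      {ω | arrivalCount T A ω ≠ ⊤}.indicator (fun _ => (1 : ℝ)) ω := by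
    intro ω; by_cases hω : arrivalCount T A ω = ⊤ <;> simp [powENat, hω, indicator]
  have hms : MeasurableSet {ω | arrivalCount T A ω ≠ ⊤} := hK (measurableSet_singleton ⊤).compl
  simp_rw [hpow] at h1
  rw [integral_indicator_const _ hms, sub_self, mul_zero, Real.exp_zero, smul_eq_mul, mul_one] at h1
  have h2 : ∀ᵐ ω ∂μ, ω ∈ {ω | arrivalCount T A ω ≠ ⊤} := by
    refine (mem_ae_iff_prob_eq_one hms).mpr ?_
    rw [measureReal_def] at h1
    exact (ENNReal.toReal_eq_one_iff _).mp h1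
  filter_upwards [h2] with ω hω
  exact Set.encard_ne_top_iff.mp hω

theorem IsPoissonProcess.integral_finprod_simpleFunc (h : IsPoissonProcess μ lam T)
    (hA : MeasurableSet A) (hfin : intensity lam A ≠ ∞) (f : SimpleFunc ℝ ℝ)
    (hf : ∀ x, f x ∈ Icc (0 : ℝ) 1) :
    ∫ ω, ∏ᶠ i, pointVal A f (T i ω) ∂μ =
      Real.exp (∫ x in A, (f x - 1) ∂(intensity lam)) := by
  classical
  have : IsFiniteMeasure ((intensity lam).restrict A) := ⟨by simpa using hfin.lt_top⟩
  let e := f.range.equivFin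
  let B : Fin f.range.card → Set ℝ := fun a => A ∩ f ⁻¹' {(e.symm a : ℝ)}
  have hB : ∀ a, MeasurableSet (B a) := fun a => hA.inter (f.measurableSet_fiber _)
  have hBfin : ∀ a, intensity lam (B a) ≠ ∞ := fun a =>
    ne_top_of_le_ne_top hfin (measure_mono inter_subset_left)
  have hdisj : Pairwise fun a b => Disjoint (B a) (B b) := by
    intro a b hab
    refine Set.disjoint_left.mpr fun x hx hx' => hab ?_
    exact e.symm.injective (Subtype.ext (hx.2.symm.trans hx'.2))
  have hc : ∀ a, (e.symm a : ℝ) ∈ Icc (0 : ℝ) 1 := by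
    intro a
    obtain ⟨x, hx⟩ := SimpleFunc.mem_range.mp (e.symm a).2
    rw [← hx]; exact hf x
  have hind := (h.indep _ B hB hdisj).comp (fun a => powENat (e.symm a : ℝ)) (fun a => .of_discrete)
  have hprod := hind.integral_fun_prod_eq_prod_integral fun a =>
    ((Measurable.of_discrete (f := powENat (e.symm a : ℝ))).comp
      (measurable_arrivalCount h.measurable (hB a))).aestronglyMeasurable
  have h1 : ∫ ω, ∏ᶠ i, pointVal A f (T i ω) ∂μ =
      ∫ ω, ∏ a, (powENat (e.symm a : ℝ) ∘ fun ω => arrivalCount T (B a) ω) ω ∂μ := by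
    refine integral_congr_ae ?_
    filter_upwards [h.ae_finite hA hfin] with ω hω
    rw [finprod_pointVal_simpleFunc hω, ← Finset.prod_coe_sort, ← e.symm.prod_comp]
    rfl
  have hint : Integrable f ((intensity lam).restrict A) :=
    Integrable.of_bound f.measurable.aestronglyMeasurable 1 (ae_of_all _ fun x => by
      rw [Real.norm_eq_abs, abs_of_nonneg (hf x).1]; exact (hf x).2)
  have h2 : ∫ x in A, (f x - 1) ∂(intensity lam) =
      ∑ a, (intensity lam (B a)).toReal * ((e.symm a : ℝ) - 1) := by
    have hone : ∑ c ∈ f.range, ((intensity lam).restrict A).real (f ⁻¹' {c}) =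
        ((intensity lam).restrict A).real univ := by
      rw [sum_measureReal_preimage_singleton _ fun c _ => f.measurableSet_fiber c]
      congr 1; ext x; simp
    rw [integral_sub hint (integrable_const _), SimpleFunc.integral_eq_sum _ hint, integral_const,
      smul_eq_mul, mul_one, ← hone, ← Finset.sum_sub_distrib, ← Finset.sum_coe_sort,
      ← e.symm.sum_comp]
    refine Finset.sum_congr rfl fun a _ => ?_
    rw [measureReal_restrict_apply (f.measurableSet_fiber _), smul_eq_mul, measureReal_def,
      inter_comm, ← mul_sub_one]
  rw [h1, hprod, h2, Real.exp_sum]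
  exact Finset.prod_congr rfl fun a _ => h.integral_powENat (hB a) (hBfin a) (hc a)

theorem IsPoissonProcess.aestronglyMeasurable_finprod (h : IsPoissonProcess μ lam T)
    (hA : MeasurableSet A) (hfin : intensity lam A ≠ ∞) {G : ℝ → ℝ} (hG : Measurable G) :
    AEStronglyMeasurable (fun ω => ∏ᶠ i, pointVal A G (T i ω)) μ := by
  refine aestronglyMeasurable_of_tendsto_ae (u := atTop)
    (f := fun m ω => ∏ i ∈ Finset.range m, pointVal A G (T i ω)) (fun m => ?_) ?_
  · exact (Finset.measurable_prod _ fun i _ =>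
      (measurable_pointVal hA hG).comp (h.measurable i)).aestronglyMeasurable
  · filter_upwards [h.ae_finite hA hfin] with ω hω
    exact tendsto_prod_range_finprod hω fun i hi => if_neg hi

/-- The Laplace functional of a Poisson process. -/
theorem IsPoissonProcess.integral_finprod (h : IsPoissonProcess μ lam T)
    (hA : MeasurableSet A) (hfin : intensity lam A ≠ ∞) {G : ℝ → ℝ} (hG : Measurable G)
    (hG₁ : ∀ x, G x ∈ Icc (0 : ℝ) 1) :
    ∫ ω, ∏ᶠ i, pointVal A G (T i ω) ∂μ =
      Real.exp (∫ x in A, (G x - 1) ∂(intensity lam)) := by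
  have : IsFiniteMeasure ((intensity lam).restrict A) := ⟨by simpa using hfin.lt_top⟩
  let f : ℕ → SimpleFunc ℝ ℝ := SimpleFunc.approxOn G hG (Icc 0 1) 0 (by simp)
  have hf : ∀ n x, f n x ∈ Icc (0 : ℝ) 1 := fun n x => SimpleFunc.approxOn_mem hG _ n x
  have hlim : ∀ x, Tendsto (fun n => f n x) atTop (𝓝 (G x)) := fun x =>
    SimpleFunc.tendsto_approxOn hG _ (subset_closure (hG₁ x))
  have h1 : Tendsto (fun n => ∫ ω, ∏ᶠ i, pointVal A (f n) (T i ω) ∂μ) atTop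
      (𝓝 (∫ ω, ∏ᶠ i, pointVal A G (T i ω) ∂μ)) := by
    refine tendsto_integral_of_dominated_convergence (fun _ => 1)
      (fun n => h.aestronglyMeasurable_finprod hA hfin (f n).measurable) (integrable_const _)
      (fun n => ?_) ?_
    · filter_upwards [h.ae_finite hA hfin] with ω hω
      rw [finprod_pointVal_eq_prod hω]
      exact norm_prod_le_one fun i => hf n _
    · filter_upwards [h.ae_finite hA hfin] with ω hω
      simp_rw [finprod_pointVal_eq_prod hω]
      exact tendsto_finsetProd _ fun i _ => hlim _
  have h2 : Tendsto (fun n => ∫ x in A, (f n x - 1) ∂(intensity lam)) atTop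
      (𝓝 (∫ x in A, (G x - 1) ∂(intensity lam))) := by
    refine tendsto_integral_of_dominated_convergence (fun _ => 1)
      (fun n => ((f n).measurable.sub_const 1).aestronglyMeasurable) (integrable_const _)
      (fun n => ae_of_all _ fun x => ?_) (ae_of_all _ fun x => (hlim x).sub_const 1)
    rw [Real.norm_eq_abs, abs_le]
    constructor <;> linarith [(hf n x).1, (hf n x).2]
  refine tendsto_nhds_unique h1 ?_
  simp_rw [fun n => h.integral_finprod_simpleFunc hA hfin (f n) (hf n)]
  exact (Real.continuous_exp.tendsto _).comp h2

theorem IsPoissonProcess.tendsto_integral_prod (h : IsPoissonProcess μ lam T)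
    (hA : MeasurableSet A) (hfin : intensity lam A ≠ ∞) {G : ℝ → ℝ} (hG : Measurable G)
    (hG₁ : ∀ x, G x ∈ Icc (0 : ℝ) 1) :
    Tendsto (fun m => ∫ ω, ∏ i ∈ Finset.range m, pointVal A G (T i ω) ∂μ) atTop
      (𝓝 (Real.exp (∫ x in A, (G x - 1) ∂(intensity lam)))) := by
  rw [← h.integral_finprod hA hfin hG hG₁]
  refine tendsto_integral_of_dominated_convergence (fun _ => 1) (fun m => ?_) (integrable_const _)
    (fun m => ae_of_all _ fun ω => norm_prod_le_one fun i => pointVal_mem_Icc hG₁ _) ?_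
  · exact (Finset.measurable_prod _ fun i _ =>
      (measurable_pointVal hA hG).comp (h.measurable i)).aestronglyMeasurable
  · filter_upwards [h.ae_finite hA hfin] with ω hω
    exact tendsto_prod_range_finprod hω fun i hi => if_neg hi

end Laplace

section Conditioning

theorem integral_comp_prodMk_of_indepFun {Ω β γ : Type*} [MeasurableSpace Ω] [MeasurableSpace β]
    [MeasurableSpace γ] {μ : Measure Ω} [IsProbabilityMeasure μ] {Y : Ω → β} {Z : Ω → γ}
    (hY : Measurable Y) (hZ : Measurable Z) (hind : IndepFun Y Z μ) {Φ : β × γ → ℝ}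
    (hΦ : Measurable Φ) {C : ℝ} (hb : ∀ x, ‖Φ x‖ ≤ C) :
    ∫ ω, Φ (Y ω, Z ω) ∂μ = ∫ ω, ∫ ω', Φ (Y ω, Z ω') ∂μ ∂μ := by
  have : IsProbabilityMeasure (μ.map Y) := Measure.isProbabilityMeasure_map hY.aemeasurable
  have : IsProbabilityMeasure (μ.map Z) := Measure.isProbabilityMeasure_map hZ.aemeasurable
  have hmap := (indepFun_iff_map_prod_eq_prod_map_map hY.aemeasurable hZ.aemeasurable).mp hind
  have hsm : StronglyMeasurable fun y => ∫ x, Φ (y, x) ∂(μ.map Z) :=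
    hΦ.stronglyMeasurable.integral_prod_right'
  have h := integral_map (f := Φ) (hY.prodMk hZ).aemeasurable (μ := μ) hΦ.aestronglyMeasurable
  rw [← h, hmap, integral_prod _
      (Integrable.of_bound hΦ.aestronglyMeasurable C (ae_of_all _ hb)),
    integral_map hY.aemeasurable hsm.aestronglyMeasurable]
  refine integral_congr_ae (ae_of_all _ fun ω => ?_)
  exact integral_map hZ.aemeasurable (hΦ.comp measurable_prodMk_left).aestronglyMeasurable

/-- Conditioning on `Y` in an expression that otherwise only depends on an independent
σ-algebra. -/
theorem integral_comp_prodMk_of_indep {Ω β : Type*} {R mΩ : MeasurableSpace Ω} [mβ : MeasurableSpace β]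
    {μ : Measure Ω} [IsProbabilityMeasure μ] {Y : Ω → β} (hR : R ≤ mΩ)
    (hY : Measurable Y) (hind : Indep (MeasurableSpace.comap Y mβ) R μ) {Φ : β × Ω → ℝ}
    (hΦ : Measurable[MeasurableSpace.prod mβ R] Φ) {C : ℝ} (hb : ∀ x, ‖Φ x‖ ≤ C) :
    ∫ ω, Φ (Y ω, ω) ∂μ = ∫ ω, ∫ ω', Φ (Y ω, ω') ∂μ ∂μ := by
  refine @integral_comp_prodMk_of_indepFun Ω β Ω mΩ mβ R μ _ Y id hY
    (measurable_id'' hR) ?_ Φ hΦ C hb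
  refine (@IndepFun_iff_Indep Ω β Ω mΩ mβ R Y id μ).mpr ?_
  rwa [MeasurableSpace.comap_id]

theorem iIndepFun.integral_finset_prod {Ω ι : Type*} [MeasurableSpace Ω] {μ : Measure Ω}
    {f : ι → Ω → ℝ} (hf : iIndepFun f μ) (hm : ∀ i, Measurable (f i)) (s : Finset ι) :
    ∫ ω, ∏ i ∈ s, f i ω ∂μ = ∏ i ∈ s, ∫ ω, f i ω ∂μ := by
  have h := (hf.precomp (g := ((↑) : s → ι)) Subtype.val_injective).integral_fun_prod_eq_prod_integral
    fun i => (hm i).aestronglyMeasurable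
  rw [← Finset.prod_coe_sort, ← h]
  simp_rw [← Finset.prod_coe_sort s]

@[to_additive]
theorem measurable_prod_range {α M : Type*} [MeasurableSpace α] [CommMonoid M] [MeasurableSpace M]
    [MeasurableMul₂ M] {N : α → ℕ} (hN : Measurable N) {f : ℕ → α → M}
    (hf : ∀ l, Measurable (f l)) : Measurable fun a => ∏ l ∈ Finset.range (N a), f l a := by
  have h : Measurable fun x : ℕ × α => ∏ l ∈ Finset.range x.1, f l x.2 :=
    measurable_from_prod_countable_right fun n =>
      Finset.measurable_prod (Finset.range n) fun l _ => hf l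
  exact h.comp (hN.prodMk measurable_id)

/-- The factor `z k` of a customer in queue `k`, and `1` for a customer outside of the network. -/
def routeWeight {J : ℕ} (z : Fin J → ℝ) (x : Option (Fin J)) : ℝ := x.elim 1 z

variable {J : ℕ} {z : Fin J → ℝ}

theorem routeWeight_eq (z : Fin J → ℝ) (x : Option (Fin J)) :
    routeWeight z x = 1 - ∑ k, (1 - z k) * (if x = some k then 1 else 0) := by
  cases x with
  | none => simp [routeWeight]
  | some a => simp [routeWeight]

theorem routeWeight_mem_Icc (hz : ∀ k, z k ∈ Icc (0 : ℝ) 1) (x : Option (Fin J)) :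
    routeWeight z x ∈ Icc (0 : ℝ) 1 := by
  cases x with
  | none => simp [routeWeight]
  | some a => exact hz a

theorem measurable_routeWeight {α : Type*} [MeasurableSpace α] {Y : α → Option (Fin J)}
    (hY : ∀ k, MeasurableSet {a | Y a = some k}) : Measurable fun a => routeWeight z (Y a) := by
  simp_rw [routeWeight_eq]
  exact measurable_const.sub (Finset.measurable_sum _ fun k _ =>
    (Measurable.ite (hY k) measurable_const measurable_const).const_mul _)

theorem prod_pow_batchOccupancy {Ω : Type*} (S : ℕ → Fin J → Ω → ℕ)
    (X : ℕ → Fin J → ℕ → ℝ≥0 → Ω → Option (Fin J)) (i : ℕ) (s : ℝ≥0) (ω : Ω) :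
    ∏ k, z k ^ batchOccupancy S X i k s ω =
      ∏ j, ∏ l ∈ Finset.range (S i j ω), routeWeight z (X i j l s ω) := by
  simp_rw [batchOccupancy, ← Finset.prod_pow_eq_pow_sum]
  rw [Finset.prod_comm]
  refine Finset.prod_congr rfl fun j _ => ?_
  rw [Finset.prod_comm]
  refine Finset.prod_congr rfl fun l _ => ?_
  cases X i j l s ω with
  | none => simp [routeWeight]
  | some a => simp [routeWeight, Finset.prod_ite_eq]

theorem measurableSpace_comap_le_of_countable {Ω α : Type*} [mΩ : MeasurableSpace Ω] [Countable α]
    {Y : Ω → α} (hY : ∀ a, MeasurableSet (Y ⁻¹' {a})) : MeasurableSpace.comap Y ⊤ ≤ mΩ := by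
  rintro _ ⟨A, -, rfl⟩
  rw [← biUnion_preimage_singleton]
  exact MeasurableSet.biUnion (to_countable A) fun a _ => hY a

theorem routeSigma_le {Ω : Type*} [mΩ : MeasurableSpace Ω] {Y : ℝ≥0 → Ω → Option (Fin J)}
    (hY : ∀ s k, MeasurableSet {ω | Y s ω = some k}) : routeSigma Y ≤ mΩ := by
  refine iSup_le fun s => measurableSpace_comap_le_of_countable fun a => ?_
  cases a with
  | none =>
    have : Y s ⁻¹' {none} = (⋃ k, {ω | Y s ω = some k})ᶜ := by
      ext ω; cases h : Y s ω <;> simp [h]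
    rw [this]
    exact (MeasurableSet.iUnion fun k => hY s k).compl
  | some k => exact hY s k

end Conditioning

section Network

/-- The mean weight, at time `s` after arrival, of a customer entering at queue `j`. -/
def routeMean {J : ℕ} (q : Fin J → Fin J → ℝ → ℝ) (z : Fin J → ℝ) (j : Fin J) (s : ℝ) : ℝ :=
  1 - ∑ k, (1 - z k) * q j k s

theorem measurable_prod_routeWeight {α Ω : Type*} [MeasurableSpace α] [MeasurableSpace Ω] {J : ℕ}
    {z : Fin J → ℝ} {X : ℕ → Fin J → ℕ → ℝ≥0 → Ω → Option (Fin J)}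
    (hX : ∀ i j l k, MeasurableSet {x : ℝ≥0 × Ω | X i j l x.1 x.2 = some k})
    {τ : ℕ → α → ℝ≥0∞} (hτ : ∀ i, Measurable (τ i)) {σ : ℕ → Fin J → α → ℕ}
    (hσ : ∀ i j, Measurable (σ i j)) {Z : α → Ω} (hZ : Measurable Z) (t : ℝ≥0) (m : ℕ) :
    Measurable fun a => ∏ i ∈ Finset.range m, if τ i a < t then
      ∏ j, ∏ l ∈ Finset.range (σ i j a), routeWeight z (X i j l (t - (τ i a).toNNReal) (Z a))
      else 1 := by
  refine Finset.measurable_prod _ fun i _ => Measurable.ite ?_ ?_ measurable_const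
  · exact measurableSet_lt (hτ i) measurable_const
  · refine Finset.measurable_prod _ fun j _ => measurable_prod_range (hσ i j) fun l => ?_
    exact (measurable_routeWeight (Y := fun x : ℝ≥0 × Ω => X i j l x.1 x.2) (hX i j l)).comp
      ((measurable_const.sub (ENNReal.measurable_toNNReal.comp (hτ i))).prodMk hZ)

theorem measurable_prod_pow_batch {Ω : Type*} [MeasurableSpace Ω] {J : ℕ}
    {S : ℕ → Fin J → Ω → ℕ} (hS : ∀ i j, Measurable (S i j)) {w : Fin J → ℝ≥0 → ℝ}
    (hw : ∀ j, Measurable (w j)) (t : ℝ≥0) (m : ℕ) :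
    Measurable fun x : (ℕ → ℝ≥0∞) × Ω => ∏ i ∈ Finset.range m, if x.1 i < t then
      ∏ j, w j (t - (x.1 i).toNNReal) ^ S i j x.2 else 1 := by
  have hτ : ∀ i, Measurable fun x : (ℕ → ℝ≥0∞) × Ω => x.1 i := fun i =>
    (measurable_pi_apply i).comp measurable_fst
  refine Finset.measurable_prod _ fun i _ => Measurable.ite ?_ ?_ measurable_const
  · exact measurableSet_lt (hτ i) measurable_const
  · refine Finset.measurable_prod _ fun j _ => Measurable.pow ?_ ((hS i j).comp measurable_snd)
    exact (hw j).comp (measurable_const.sub (ENNReal.measurable_toNNReal.comp (hτ i)))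

theorem norm_prod_ite_le_one {ι : Type*} {s : Finset ι} {c : ι → Prop} [DecidablePred c]
    {u : ι → ℝ} (hu : ∀ i, u i ∈ Icc (0 : ℝ) 1) : ‖∏ i ∈ s, if c i then u i else 1‖ ≤ 1 :=
  norm_prod_le_one fun i => by split_ifs <;> simp [(hu i).1, (hu i).2]

theorem prod_mem_Icc {ι : Type*} {s : Finset ι} {u : ι → ℝ} (hu : ∀ i, u i ∈ Icc (0 : ℝ) 1) :
    ∏ i ∈ s, u i ∈ Icc (0 : ℝ) 1 :=
  ⟨Finset.prod_nonneg fun i _ => (hu i).1, Finset.prod_le_one (fun i _ => (hu i).1) fun i _ => (hu i).2⟩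

theorem comap_pi_le {Ω ι : Type*} {β : ι → Type*} {R : MeasurableSpace Ω}
    [mβ : ∀ i, MeasurableSpace (β i)] {f : ∀ i, Ω → β i}
    (hf : ∀ i, MeasurableSpace.comap (f i) (mβ i) ≤ R) :
    MeasurableSpace.comap (fun ω i => f i ω) MeasurableSpace.pi ≤ R :=
  measurable_iff_comap_le.mp (measurable_pi_iff.mpr fun i => measurable_iff_comap_le.mpr (hf i))

namespace IsNetwork

variable {Ω : Type*} [mΩ : MeasurableSpace Ω] {μ : Measure Ω} {J : ℕ}
  {lam : ℝ → ℝ} {q : Fin J → Fin J → ℝ → ℝ} {T : ℕ → Ω → ℝ≥0∞} {S : ℕ → Fin J → Ω → ℕ}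
  {X : ℕ → Fin J → ℕ → ℝ≥0 → Ω → Option (Fin J)} {z : Fin J → ℝ}

theorem sourceSigma_le (h : IsNetwork μ lam q T S X) (a : Unit ⊕ ℕ ⊕ (ℕ × Fin J × ℕ)) :
    sourceSigma T S X a ≤ mΩ := by
  rcases a with _ | i | c
  · exact iSup_le fun i => (h.arrivals.measurable i).comap_le
  · exact iSup_le fun j => (h.batch_measurable i j).comap_le
  · exact routeSigma_le fun s k => h.route_measurable _ _ _ s k

/-- The σ-algebra generated by all routes. -/
abbrev allRoutes (X : ℕ → Fin J → ℕ → ℝ≥0 → Ω → Option (Fin J)) : MeasurableSpace Ω :=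
  ⨆ c : ℕ × Fin J × ℕ, routeSigma (X c.1 c.2.1 c.2.2)

/-- The σ-algebra generated by all batches. -/
abbrev allBatches (S : ℕ → Fin J → Ω → ℕ) : MeasurableSpace Ω :=
  ⨆ i, ⨆ j, MeasurableSpace.comap (S i j) inferInstance

theorem allRoutes_le (h : IsNetwork μ lam q T S X) : allRoutes X ≤ mΩ :=
  iSup_le fun c => h.sourceSigma_le (.inr (.inr c))

theorem allBatches_le (h : IsNetwork μ lam q T S X) : allBatches S ≤ mΩ :=
  iSup_le fun i => h.sourceSigma_le (.inr (.inl i))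

theorem indep_arrivals_batches_routes (h : IsNetwork μ lam q T S X) :
    Indep (MeasurableSpace.comap
      (fun ω => ((fun i => T i ω, fun i j => S i j ω) : (ℕ → ℝ≥0∞) × (ℕ → Fin J → ℕ)))
      inferInstance) (allRoutes X) μ := by
  have hd : Disjoint ({Sum.inl ()} ∪ range (Sum.inr ∘ Sum.inl) : Set (Unit ⊕ ℕ ⊕ (ℕ × Fin J × ℕ)))
      (range (Sum.inr ∘ Sum.inr)) := by
    rw [Set.disjoint_left]
    rintro _ (rfl | ⟨i, rfl⟩) ⟨c, hc⟩ <;> simp at hc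
  refine indep_of_indep_of_le_left (indep_of_indep_of_le_right
    (indep_iSup_of_disjoint h.sourceSigma_le h.independent hd) ?_) ?_
  · refine iSup_le fun c => le_iSup₂_of_le (Sum.inr (Sum.inr c)) ⟨c, rfl⟩ le_rfl
  · have hT : ∀ i, MeasurableSpace.comap (T i) inferInstance ≤
        ⨆ a ∈ ({Sum.inl ()} ∪ range (Sum.inr ∘ Sum.inl) : Set (Unit ⊕ ℕ ⊕ (ℕ × Fin J × ℕ))),
          sourceSigma T S X a := fun i =>
      le_iSup₂_of_le (Sum.inl ()) (Or.inl rfl)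
        (le_iSup (fun i => MeasurableSpace.comap (T i) inferInstance) i)
    have hS : ∀ i j, MeasurableSpace.comap (S i j) inferInstance ≤
        ⨆ a ∈ ({Sum.inl ()} ∪ range (Sum.inr ∘ Sum.inl) : Set (Unit ⊕ ℕ ⊕ (ℕ × Fin J × ℕ))),
          sourceSigma T S X a := fun i j =>
      le_iSup₂_of_le (Sum.inr (Sum.inl i)) (Or.inr ⟨i, rfl⟩)
        (le_iSup (fun j => MeasurableSpace.comap (S i j) inferInstance) j)
    refine (MeasurableSpace.comap_prodMk _ _).trans_le (sup_le ?_ ?_)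
    · exact comap_pi_le hT
    · exact comap_pi_le fun i => comap_pi_le (hS i)

theorem indep_arrivals_batches (h : IsNetwork μ lam q T S X) :
    Indep (MeasurableSpace.comap (fun ω => (fun i => T i ω : ℕ → ℝ≥0∞)) inferInstance)
      (allBatches S) μ := by
  have hd : Disjoint ({Sum.inl ()} : Set (Unit ⊕ ℕ ⊕ (ℕ × Fin J × ℕ)))
      (range (Sum.inr ∘ Sum.inl)) := by
    rw [Set.disjoint_left]
    rintro _ rfl ⟨c, hc⟩; simp at hc
  refine indep_of_indep_of_le_left (indep_of_indep_of_le_right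
    (indep_iSup_of_disjoint h.sourceSigma_le h.independent hd) ?_) ?_
  · refine iSup_le fun i => le_iSup₂_of_le (Sum.inr (Sum.inl i)) ⟨i, rfl⟩ le_rfl
  · refine comap_pi_le fun i => ?_
    exact le_iSup₂_of_le (Sum.inl ()) rfl
        (le_iSup (fun i => MeasurableSpace.comap (T i) inferInstance) i)

theorem measurableSet_route (h : IsNetwork μ lam q T S X) (i : ℕ) (j : Fin J) (l : ℕ) (k : Fin J) :
    MeasurableSet[MeasurableSpace.prod inferInstance (allRoutes X)]
      {x : ℝ≥0 × Ω | X i j l x.1 x.2 = some k} := by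
  have hle : routeSigma (X i j l) ≤ allRoutes X :=
    le_iSup (fun c : ℕ × Fin J × ℕ => routeSigma (X c.1 c.2.1 c.2.2)) (i, j, l)
  exact sup_le_sup le_rfl (MeasurableSpace.comap_mono hle) _ (h.route_jointly_measurable i j l k)

theorem measurable_routeWeight (h : IsNetwork μ lam q T S X) (i : ℕ) (j : Fin J) (l : ℕ) (s : ℝ≥0) :
    Measurable fun ω => routeWeight z (X i j l s ω) :=
  BatchQueue.measurable_routeWeight fun k => h.route_measurable i j l s k

theorem iIndepFun_routeWeight (h : IsNetwork μ lam q T S X) (s : ℕ → ℝ≥0) :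
    iIndepFun (fun (c : ℕ × Fin J × ℕ) ω => routeWeight z (X c.1 c.2.1 c.2.2 (s c.1) ω)) μ := by
  have h1 := h.independent.precomp (g := fun c : ℕ × Fin J × ℕ => Sum.inr (Sum.inr c))
    (Sum.inr_injective.comp Sum.inr_injective)
  refine (iIndepFun_iff_iIndep _ _ _).mpr (iIndep_of_iIndep_of_le h1 fun c => ?_)
  rintro _ ⟨A, -, rfl⟩
  have : (fun ω => routeWeight z (X c.1 c.2.1 c.2.2 (s c.1) ω)) ⁻¹' A =
      X c.1 c.2.1 c.2.2 (s c.1) ⁻¹' (routeWeight z ⁻¹' A) := rfl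
  rw [this]
  exact le_iSup (fun s => MeasurableSpace.comap (X c.1 c.2.1 c.2.2 s) ⊤) (s c.1) _
    ⟨_, trivial, rfl⟩

variable [IsProbabilityMeasure μ]

theorem integral_routeWeight (h : IsNetwork μ lam q T S X) (i : ℕ) (j : Fin J) (l : ℕ) (s : ℝ≥0) :
    ∫ ω, routeWeight z (X i j l s ω) ∂μ = routeMean q z j s := by
  have hind : ∀ k, (fun ω => if X i j l s ω = some k then (1 : ℝ) else 0) =
      {ω | X i j l s ω = some k}.indicator fun _ => 1 := by
    intro k; ext ω; simp [indicator]
  have hint : ∀ k, Integrable (fun ω => if X i j l s ω = some k then (1 : ℝ) else 0) μ := by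
    intro k
    rw [hind]
    exact (integrable_const _).indicator (h.route_measurable i j l s k)
  simp_rw [routeWeight_eq]
  rw [integral_sub (integrable_const _)
    (integrable_finsetSum _ fun k _ => (hint k).const_mul _),
    integral_finsetSum _ fun k _ => (hint k).const_mul _, routeMean]
  congr 1
  · simp
  · refine Finset.sum_congr rfl fun k _ => ?_
    rw [integral_const_mul, hind, integral_indicator_const _ (h.route_measurable i j l s k),
      h.route_law, smul_eq_mul, mul_one]

theorem routeMean_mem_Icc (h : IsNetwork μ lam q T S X) (hz : ∀ k, z k ∈ Icc (0 : ℝ) 1) (j : Fin J)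
    (s : ℝ≥0) : routeMean q z j s ∈ Icc (0 : ℝ) 1 := by
  rw [← h.integral_routeWeight 0 j 0 s]
  have hint : Integrable (fun ω => routeWeight z (X 0 j 0 s ω)) μ :=
    Integrable.of_bound (h.measurable_routeWeight 0 j 0 s).aestronglyMeasurable 1
      (ae_of_all _ fun ω => by
        rw [Real.norm_eq_abs, abs_of_nonneg (routeWeight_mem_Icc hz _).1]
        exact (routeWeight_mem_Icc hz _).2)
  refine ⟨integral_nonneg fun ω => (routeWeight_mem_Icc hz _).1, ?_⟩
  simpa using integral_mono hint (integrable_const (1 : ℝ)) fun ω => (routeWeight_mem_Icc hz _).2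

theorem integral_prod_routeWeight (h : IsNetwork μ lam q T S X) (t : ℝ≥0) (m : ℕ)
    (τ : ℕ → ℝ≥0∞) (σ : ℕ → Fin J → ℕ) :
    ∫ ω, ∏ i ∈ Finset.range m, (if τ i < t then
      ∏ j, ∏ l ∈ Finset.range (σ i j), routeWeight z (X i j l (t - (τ i).toNNReal) ω) else 1) ∂μ =
    ∏ i ∈ Finset.range m, if τ i < t then
      ∏ j, routeMean q z j (t - (τ i).toNNReal : ℝ≥0) ^ σ i j else 1 := by
  let F : Finset (Σ _ : ℕ, Σ _ : Fin J, ℕ) := ((Finset.range m).filter fun i => τ i < t).sigma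
    fun i => Finset.univ.sigma fun j => Finset.range (σ i j)
  have hinj : Function.Injective fun c : (Σ _ : ℕ, Σ _ : Fin J, ℕ) => (c.1, c.2.1, c.2.2) := by
    rintro ⟨a, b, c⟩ ⟨a', b', c'⟩ hc
    simp only [Prod.mk.injEq] at hc
    obtain ⟨rfl, rfl, rfl⟩ := hc
    rfl
  have h1 := iIndepFun.integral_finset_prod
    ((h.iIndepFun_routeWeight (z := z) fun i => t - (τ i).toNNReal).precomp hinj)
    (fun c => h.measurable_routeWeight _ _ _ _) F
  simp only [F, Finset.prod_sigma, h.integral_routeWeight, Finset.prod_const, Finset.card_range,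
    Finset.prod_filter] at h1
  exact h1

theorem integral_prod_batches (h : IsNetwork μ lam q T S X) (t : ℝ≥0) (m : ℕ) (τ : ℕ → ℝ≥0∞)
    (w : ℕ → Fin J → ℝ) :
    ∫ ω, ∏ i ∈ Finset.range m, (if τ i < t then ∏ j, w i j ^ S i j ω else 1) ∂μ =
    ∏ i ∈ Finset.range m, if τ i < t then ∫ ω, ∏ j, w i j ^ S i j ω ∂μ else 1 := by
  have h1 := h.independent.precomp (g := fun i : ℕ => Sum.inr (Sum.inl i))
    (Sum.inr_injective.comp Sum.inl_injective)
  have hm : ∀ i, Measurable[⨆ j, MeasurableSpace.comap (S i j) inferInstance]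
      fun ω => if τ i < t then ∏ j, w i j ^ S i j ω else 1 := by
    intro i
    split_ifs
    · refine Finset.measurable_prod _ fun j _ => ?_
      have : Measurable[⨆ j, MeasurableSpace.comap (S i j) inferInstance] (S i j) :=
        measurable_iff_comap_le.mpr (le_iSup (fun j => MeasurableSpace.comap (S i j) inferInstance) j)
      exact (Measurable.of_discrete (f := fun n : ℕ => w i j ^ n)).comp this
    · exact measurable_const
  have h2 : iIndepFun (fun i ω => if τ i < t then ∏ j, w i j ^ S i j ω else 1) μ :=
    (iIndepFun_iff_iIndep _ _ _).mpr (iIndep_of_iIndep_of_le h1 fun i =>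
      measurable_iff_comap_le.mp (hm i))
  rw [iIndepFun.integral_finset_prod h2 fun i =>
    (hm i).mono (h.sourceSigma_le (.inr (.inl i))) le_rfl]
  refine Finset.prod_congr rfl fun i _ => ?_
  split_ifs
  · rfl
  · simp

theorem measurable_routeProb (h : IsNetwork μ lam q T S X) (j k : Fin J) :
    Measurable fun s : ℝ≥0 => q j k s := by
  have h1 : MeasurableSet {x : ℝ≥0 × Ω | X 0 j 0 x.1 x.2 = some k} :=
    sup_le_sup le_rfl (MeasurableSpace.comap_mono h.allRoutes_le) _ (h.measurableSet_route 0 j 0 k)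
  simp_rw [fun s : ℝ≥0 => (h.route_law 0 j 0 s k).symm]
  exact (measurable_measure_prodMk_left h1).ennreal_toReal

theorem measurable_routeMean (h : IsNetwork μ lam q T S X) (j : Fin J) :
    Measurable fun s : ℝ≥0 => routeMean q z j s :=
  measurable_const.sub (Finset.measurable_sum _ fun k _ => (h.measurable_routeProb j k).const_mul _)

theorem integral_prod_occupancy (h : IsNetwork μ lam q T S X) (hz : ∀ k, z k ∈ Icc (0 : ℝ) 1)
    (t : ℝ≥0) (m : ℕ) :
    ∫ ω, ∏ i ∈ Finset.range m, (if T i ω < t then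
      ∏ k, z k ^ batchOccupancy S X i k (t - (T i ω).toNNReal) ω else 1) ∂μ =
    ∫ ω, ∏ i ∈ Finset.range m, (if T i ω < t then
      ∫ ω', ∏ j, routeMean q z j (t - (T i ω).toNNReal : ℝ≥0) ^ S i j ω' ∂μ else 1) ∂μ := by
  have hTm : Measurable fun ω => (fun i => T i ω : ℕ → ℝ≥0∞) :=
    measurable_pi_iff.mpr h.arrivals.measurable
  have hSm : Measurable fun ω => (fun i j => S i j ω : ℕ → Fin J → ℕ) :=
    measurable_pi_iff.mpr fun i => measurable_pi_iff.mpr fun j => h.batch_measurable i j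
  let Φ : ((ℕ → ℝ≥0∞) × (ℕ → Fin J → ℕ)) × Ω → ℝ := fun x =>
    ∏ i ∈ Finset.range m, if x.1.1 i < t then
      ∏ j, ∏ l ∈ Finset.range (x.1.2 i j), routeWeight z (X i j l (t - (x.1.1 i).toNNReal) x.2)
      else 1
  have hΦ : Measurable[MeasurableSpace.prod inferInstance (allRoutes X)] Φ := by
    refine @measurable_prod_routeWeight (((ℕ → ℝ≥0∞) × (ℕ → Fin J → ℕ)) × Ω) Ω (MeasurableSpace.prod inferInstance (allRoutes X))
      (allRoutes X) J z X h.measurableSet_route (fun i x => x.1.1 i) (fun i => ?_)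
      (fun i j x => x.1.2 i j) (fun i j => ?_) Prod.snd ?_ t m
    · exact (measurable_pi_apply i).comp (measurable_fst.comp
        (@measurable_fst _ _ inferInstance (allRoutes X)))
    · exact (measurable_pi_apply j).comp ((measurable_pi_apply i).comp (measurable_snd.comp
        (@measurable_fst _ _ inferInstance (allRoutes X))))
    · exact @measurable_snd _ _ inferInstance (allRoutes X)
  have h1 := integral_comp_prodMk_of_indep h.allRoutes_le (hTm.prodMk hSm)
    h.indep_arrivals_batches_routes hΦ (C := 1) fun x => norm_prod_ite_le_one fun i =>
      prod_mem_Icc fun j => prod_mem_Icc fun l => routeWeight_mem_Icc hz _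
  simp only [Φ, h.integral_prod_routeWeight] at h1
  simp_rw [prod_pow_batchOccupancy]
  rw [h1]
  let Ψ : (ℕ → ℝ≥0∞) × Ω → ℝ := fun x =>
    ∏ i ∈ Finset.range m, if x.1 i < t then
      ∏ j, routeMean q z j (t - (x.1 i).toNNReal : ℝ≥0) ^ S i j x.2 else 1
  have hΨ : Measurable[MeasurableSpace.prod inferInstance (allBatches S)] Ψ :=
    @measurable_prod_pow_batch Ω (allBatches S) J S
      (fun i j => measurable_iff_comap_le.mpr (le_iSup_of_le i (le_iSup_of_le j le_rfl)))
      (fun j s => routeMean q z j (s : ℝ≥0)) h.measurable_routeMean t m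
  have h2 := integral_comp_prodMk_of_indep h.allBatches_le hTm h.indep_arrivals_batches hΨ (C := 1)
    fun x => norm_prod_ite_le_one fun i => prod_mem_Icc fun j =>
      ⟨pow_nonneg (h.routeMean_mem_Icc hz _ _).1 _, pow_le_one₀ (h.routeMean_mem_Icc hz _ _).1
        (h.routeMean_mem_Icc hz _ _).2⟩
  have h3 : ∀ τ : ℕ → ℝ≥0∞, ∫ ω', Ψ (τ, ω') ∂μ = ∏ i ∈ Finset.range m, if τ i < t then
      ∫ ω', ∏ j, routeMean q z j (t - (τ i).toNNReal : ℝ≥0) ^ S i j ω' ∂μ else 1 := fun τ =>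
    h.integral_prod_batches t m τ fun i j => routeMean q z j (t - (τ i).toNNReal : ℝ≥0)
  simp_rw [h3] at h2
  exact h2

end IsNetwork
end Network

section Occupancy
open Filter Topology

theorem locallyIntegrableOn_integrableOn_Icc {lam : ℝ → ℝ} (hlam : LocallyIntegrableOn lam (Ici 0))
    (t : ℝ) : IntegrableOn lam (Icc 0 t) :=
  hlam.integrableOn_compact_subset Icc_subset_Ici_self isCompact_Icc

theorem restrict_intensity_Ico (lam : ℝ → ℝ) (t : ℝ) :
    (intensity lam).restrict (Ico 0 t) =
      (volume.restrict (Ico 0 t)).withDensity fun τ => ENNReal.ofReal (lam τ) := by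
  rw [intensity, restrict_withDensity measurableSet_Ico, Measure.restrict_restrict measurableSet_Ico,
    inter_eq_self_of_subset_left Ico_subset_Ici_self]

theorem intensity_Ico_ne_top {lam : ℝ → ℝ} (hlam : LocallyIntegrableOn lam (Ici 0)) (t : ℝ) :
    intensity lam (Ico 0 t) ≠ ∞ := by
  rw [← Measure.restrict_apply_univ, restrict_intensity_Ico, withDensity_apply _ MeasurableSet.univ,
    Measure.restrict_univ]
  exact ((locallyIntegrableOn_integrableOn_Icc hlam t).mono_set Ico_subset_Icc_self).lintegral_lt_top.ne

theorem setIntegral_intensity {lam : ℝ → ℝ} (hlam_nonneg : ∀ τ, 0 ≤ τ → 0 ≤ lam τ)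
    (hlam : LocallyIntegrableOn lam (Ici 0)) {t : ℝ} (ht : 0 ≤ t) (f : ℝ → ℝ) :
    ∫ τ in Ico 0 t, f τ ∂(intensity lam) = ∫ τ in (0 : ℝ)..t, lam τ * f τ := by
  have hm : AEMeasurable lam (volume.restrict (Ico 0 t)) :=
    ((locallyIntegrableOn_integrableOn_Icc hlam t).mono_set Ico_subset_Icc_self).aemeasurable
  rw [restrict_intensity_Ico, integral_withDensity_eq_integral_toReal_smul₀ hm.ennreal_ofReal
    (ae_of_all _ fun _ => ENNReal.ofReal_lt_top), intervalIntegral.integral_of_le ht,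
    integral_Ioc_eq_integral_Ioo, ← integral_Ico_eq_integral_Ioo]
  refine setIntegral_congr_fun measurableSet_Ico fun τ hτ => ?_
  simp only [smul_eq_mul]
  rw [ENNReal.toReal_ofReal (hlam_nonneg τ hτ.1)]

variable {Ω : Type*} {J : ℕ} {T : ℕ → Ω → ℝ≥0∞} {S : ℕ → Fin J → Ω → ℕ}
  {X : ℕ → Fin J → ℕ → ℝ≥0 → Ω → Option (Fin J)} {z : Fin J → ℝ}

theorem lt_coe_iff_mem_Ico {x : ℝ≥0∞} {t : ℝ≥0} :
    x < t ↔ x ≠ ∞ ∧ x.toReal ∈ Ico (0 : ℝ) t := by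
  constructor
  · intro h
    have hx : x ≠ ∞ := h.ne_top
    exact ⟨hx, ENNReal.toReal_nonneg, by simpa using (ENNReal.toReal_lt_toReal hx ENNReal.coe_ne_top).mpr h⟩
  · rintro ⟨hx, -, h⟩
    exact (ENNReal.toReal_lt_toReal hx ENNReal.coe_ne_top).mp (by simpa using h)

open Classical in
/-- The number of customers in queue `k` at time `t` that belong to one of the first `m` batches. -/
noncomputable def partialOccupancy (T : ℕ → Ω → ℝ≥0∞) (S : ℕ → Fin J → Ω → ℕ)
    (X : ℕ → Fin J → ℕ → ℝ≥0 → Ω → Option (Fin J)) (t : ℝ≥0) (m : ℕ) (ω : Ω) (k : Fin J) : ℕ :=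
  ∑ i ∈ Finset.range m, if T i ω < t then batchOccupancy S X i k (t - (T i ω).toNNReal) ω else 0

theorem prod_pow_partialOccupancy (t : ℝ≥0) (m : ℕ) (ω : Ω) :
    ∏ k, z k ^ partialOccupancy T S X t m ω k = ∏ i ∈ Finset.range m, if T i ω < t then
      ∏ k, z k ^ batchOccupancy S X i k (t - (T i ω).toNNReal) ω else 1 := by
  simp_rw [partialOccupancy, ← Finset.prod_pow_eq_pow_sum]
  rw [Finset.prod_comm]
  refine Finset.prod_congr rfl fun i _ => ?_
  split_ifs <;> simp

theorem eventually_occupancy_eq {ω : Ω} {t : ℝ≥0}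
    (hI : {i | T i ω ≠ ∞ ∧ (T i ω).toReal ∈ Ico (0 : ℝ) t}.Finite) :
    ∀ᶠ m in atTop, ∀ k, occupancy T S X t k ω = (partialOccupancy T S X t m ω k : ℕ∞) := by
  obtain ⟨M, hM⟩ := hI.bddAbove
  filter_upwards [eventually_gt_atTop M] with m hm k
  rw [occupancy, tsum_eq_sum (s := Finset.range m), partialOccupancy, Nat.cast_sum]
  · refine Finset.sum_congr rfl fun i _ => ?_
    split_ifs <;> simp
  · intro i hi
    refine if_neg fun h => hi ?_
    exact Finset.mem_range.mpr ((hM (lt_coe_iff_mem_Ico.mp h)).trans_lt hm)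

/-- The vector of the numbers of customers in the queues. -/
noncomputable def occupancyVec (T : ℕ → Ω → ℝ≥0∞) (S : ℕ → Fin J → Ω → ℕ)
    (X : ℕ → Fin J → ℕ → ℝ≥0 → Ω → Option (Fin J)) (t : ℝ≥0) (ω : Ω) (k : Fin J) : ℕ :=
  (occupancy T S X t k ω).toNat

namespace IsNetwork

variable [MeasurableSpace Ω] {μ : Measure Ω}
  {lam : ℝ → ℝ} {q : Fin J → Fin J → ℝ → ℝ}

theorem measurable_partialOccupancy (h : IsNetwork μ lam q T S X) (t : ℝ≥0) (m : ℕ) :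
    Measurable (partialOccupancy T S X t m) := by
  refine measurable_pi_iff.mpr fun k => Finset.measurable_sum _ fun i _ =>
    Measurable.ite (measurableSet_lt (h.arrivals.measurable i) measurable_const) ?_ measurable_const
  refine Finset.measurable_sum _ fun j _ => measurable_sum_range (h.batch_measurable i j) fun l => ?_
  refine Measurable.ite ?_ measurable_const measurable_const
  have h1 : MeasurableSet {x : ℝ≥0 × Ω | X i j l x.1 x.2 = some k} :=
    sup_le_sup le_rfl (MeasurableSpace.comap_mono h.allRoutes_le) _ (h.measurableSet_route i j l k)
  exact ((measurable_const.sub (ENNReal.measurable_toNNReal.comp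
    (h.arrivals.measurable i))).prodMk measurable_id) h1

variable [IsProbabilityMeasure μ]

theorem ae_eventually_occupancy_eq (h : IsNetwork μ lam q T S X)
    (hlam : LocallyIntegrableOn lam (Ici 0)) (t : ℝ≥0) : ∀ᵐ ω ∂μ, ∀ᶠ m in atTop,
      ∀ k, occupancy T S X t k ω = (partialOccupancy T S X t m ω k : ℕ∞) := by
  filter_upwards [h.arrivals.ae_finite measurableSet_Ico (intensity_Ico_ne_top hlam t)] with ω hω
  exact eventually_occupancy_eq hω

theorem ae_eventually_occupancyVec_eq (h : IsNetwork μ lam q T S X)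
    (hlam : LocallyIntegrableOn lam (Ici 0)) (t : ℝ≥0) :
    ∀ᵐ ω ∂μ, ∀ᶠ m in atTop, partialOccupancy T S X t m ω = occupancyVec T S X t ω := by
  filter_upwards [h.ae_eventually_occupancy_eq hlam t] with ω hω
  filter_upwards [hω] with m hm
  ext k
  rw [occupancyVec, hm k, ENat.toNat_natCast]

theorem aemeasurable_occupancyVec (h : IsNetwork μ lam q T S X)
    (hlam : LocallyIntegrableOn lam (Ici 0)) (t : ℝ≥0) : AEMeasurable (occupancyVec T S X t) μ := by
  refine aemeasurable_of_tendsto_metrizable_ae atTop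
    (fun m => (h.measurable_partialOccupancy t m).aemeasurable) ?_
  filter_upwards [h.ae_eventually_occupancyVec_eq hlam t] with ω hω
  exact tendsto_const_nhds.congr' (hω.mono fun m hm => hm.symm)

theorem occupancyProb_eq (h : IsNetwork μ lam q T S X)
    (hlam : LocallyIntegrableOn lam (Ici 0)) (t : ℝ≥0) (n : Fin J → ℕ) :
    occupancyProb μ T S X t n = (μ.map (occupancyVec T S X t)).real {n} := by
  rw [map_measureReal_apply_of_aemeasurable (h.aemeasurable_occupancyVec hlam t)
    (measurableSet_singleton _), occupancyProb]
  refine measureReal_congr ?_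
  filter_upwards [h.ae_eventually_occupancy_eq hlam t] with ω hω
  obtain ⟨m, hm⟩ := hω.exists
  refine propext ⟨fun hn => ?_, fun hn k => ?_⟩
  · refine funext fun k => ?_
    rw [occupancyVec, hn k, ENat.toNat_natCast]
  · have : occupancyVec T S X t ω k = n k := congrFun hn k
    rw [← this, occupancyVec, hm k, ENat.toNat_natCast]

/-- The probability generating function of the vector of the numbers of customers. -/
theorem hasSum_occupancyProb (h : IsNetwork μ lam q T S X)
    (hlam : LocallyIntegrableOn lam (Ici 0)) (t : ℝ≥0) (hz : ∀ k, z k ∈ Icc (0 : ℝ) 1) :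
    HasSum (fun n : Fin J → ℕ => occupancyProb μ T S X t n * ∏ k, z k ^ n k)
      (∫ ω, ∏ k, z k ^ occupancyVec T S X t ω k ∂μ) := by
  have hN := h.aemeasurable_occupancyVec hlam t
  have : IsProbabilityMeasure (μ.map (occupancyVec T S X t)) := Measure.isProbabilityMeasure_map hN
  have hm : Measurable fun n : Fin J → ℕ => ∏ k, z k ^ n k := .of_discrete
  have hint : Integrable (fun n : Fin J → ℕ => ∏ k, z k ^ n k) (μ.map (occupancyVec T S X t)) :=
    Integrable.of_bound hm.aestronglyMeasurable 1 (ae_of_all _ fun n => by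
      rw [Real.norm_eq_abs, abs_of_nonneg (prod_pow_mem_Icc hz n).1]
      exact (prod_pow_mem_Icc hz n).2)
  have h1 := integral_map hN hm.aestronglyMeasurable
  rw [← h1, integral_countable hint]
  simp_rw [h.occupancyProb_eq hlam t, ← smul_eq_mul]
  refine Summable.hasSum (Summable.of_nonneg_of_le
    (fun n => mul_nonneg measureReal_nonneg (prod_pow_mem_Icc hz n).1)
    (fun n => mul_le_of_le_one_right measureReal_nonneg (prod_pow_mem_Icc hz n).2) ?_)
  refine ENNReal.summable_toReal (ne_of_eq_of_ne (measure_iUnion (fun a b hab => ?_) fun n =>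
    measurableSet_singleton n).symm (measure_ne_top _ _))
  simpa [Function.onFun] using hab

theorem integral_prod_pow_occupancyVec (h : IsNetwork μ lam q T S X)
    (hlam : LocallyIntegrableOn lam (Ici 0)) (t : ℝ≥0) (hz : ∀ k, z k ∈ Icc (0 : ℝ) 1)
    {g : (Fin J → ℝ) → ℝ} (hg : Measurable g)
    (hg₁ : ∀ w, (∀ j, w j ∈ Icc (0 : ℝ) 1) → g w ∈ Icc (0 : ℝ) 1)
    (hbatch : ∀ i, ∀ w : Fin J → ℝ, (∀ j, w j ∈ Icc (0 : ℝ) 1) → ∫ ω, ∏ j, w j ^ S i j ω ∂μ = g w) :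
    ∫ ω, ∏ k, z k ^ occupancyVec T S X t ω k ∂μ = Real.exp (∫ x in Ico (0 : ℝ) t,
      (g (fun j => routeMean q z j ((t - x : ℝ).toNNReal)) - 1) ∂(intensity lam)) := by
  have hlim := h.arrivals.tendsto_integral_prod measurableSet_Ico (intensity_Ico_ne_top hlam t)
    (G := fun x => g fun j => routeMean q z j ((t - x : ℝ).toNNReal))
    (hg.comp (measurable_pi_iff.mpr fun j => (h.measurable_routeMean j).comp
      (measurable_const.sub measurable_id).real_toNNReal))
    fun x => hg₁ _ fun j => h.routeMean_mem_Icc hz j _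
  refine tendsto_nhds_unique ?_ hlim
  have h1 : ∀ m, ∫ ω, ∏ i ∈ Finset.range m, pointVal (Ico (0 : ℝ) t)
      (fun x => g fun j => routeMean q z j ((t - x : ℝ).toNNReal)) (T i ω) ∂μ =
      ∫ ω, ∏ k, z k ^ partialOccupancy T S X t m ω k ∂μ := by
    intro m
    simp_rw [prod_pow_partialOccupancy]
    rw [h.integral_prod_occupancy hz]
    refine integral_congr_ae (ae_of_all _ fun ω => Finset.prod_congr rfl fun i _ => ?_)
    by_cases hi : T i ω < t
    · rw [if_pos hi, hbatch i _ fun j => h.routeMean_mem_Icc hz j _]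
      refine (if_pos (lt_coe_iff_mem_Ico.mp hi)).trans ?_
      congr
    · rw [if_neg hi]
      exact if_neg fun h' => hi (lt_coe_iff_mem_Ico.mpr h')
  simp_rw [h1]
  refine tendsto_integral_of_dominated_convergence (fun _ => 1) (fun m => ?_) (integrable_const _)
    (fun m => ae_of_all _ fun ω => ?_) ?_
  · exact ((Measurable.of_discrete (f := fun n : Fin J → ℕ => ∏ k, z k ^ n k)).comp
      (h.measurable_partialOccupancy t m)).aestronglyMeasurable
  · rw [Real.norm_eq_abs, abs_of_nonneg (prod_pow_mem_Icc hz _).1]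
    exact (prod_pow_mem_Icc hz _).2
  · filter_upwards [h.ae_eventually_occupancyVec_eq hlam t] with ω hω
    exact tendsto_const_nhds.congr' (hω.mono fun m hm =>
      congrArg (fun n : Fin J → ℕ => ∏ k, z k ^ n k) hm.symm)

end IsNetwork
end Occupancy

section LogBatches

/-- The mean weight, at time `t`, of a logarithmic batch that arrives at time `τ`. -/
noncomputable def batchMean {J : ℕ} (ρ : ℝ) (p : Fin J → ℝ) (q : Fin J → Fin J → ℝ → ℝ) (t : ℝ)
    (z : Fin J → ℝ) (τ : ℝ) : ℝ :=
  Real.log (1 - ρ * ∑ j, p j * routeMean q z j ((t - τ).toNNReal : ℝ)) / Real.log (1 - ρ)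

theorem hasSum_finsupp_of_hasSum_pi {σ : Type*} [Finite σ] {f : (σ → ℕ) → ℝ} {a : ℝ}
    (hf : HasSum f a) : HasSum (fun i : σ →₀ ℕ => f i) a :=
  Finsupp.equivFunOnFinite.hasSum_iff.mpr hf

theorem log_div_mem_Icc {ρ x : ℝ} (hρ₀ : 0 < ρ) (hρ₁ : ρ < 1) (hx : x ∈ Icc (0 : ℝ) 1) :
    Real.log (1 - ρ * x) / Real.log (1 - ρ) ∈ Icc (0 : ℝ) 1 := by
  have hL : Real.log (1 - ρ) < 0 := Real.log_neg (by linarith) (by linarith)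
  have h0 : 1 - ρ ≤ 1 - ρ * x := by nlinarith [hx.2]
  have h1 : 1 - ρ * x ≤ 1 := by nlinarith [hx.1]
  exact ⟨div_nonneg_of_nonpos (Real.log_nonpos (by linarith) h1) hL.le,
    (div_le_one_of_neg hL).mpr (Real.log_le_log (by linarith) h0)⟩

theorem measurable_logJump {J : ℕ} (ρ : ℝ) (i : Fin J → ℕ) :
    Measurable fun q : Fin J → ℝ => logJump ρ q i := by
  unfold logJump
  split_ifs
  · exact measurable_const
  · fun_prop

theorem sum_mul_mem_Icc {ι : Type*} [Fintype ι] {p w : ι → ℝ} (hp : ∀ j, 0 ≤ p j)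
    (hp_sum : ∑ j, p j = 1) (hw : ∀ j, w j ∈ Icc (0 : ℝ) 1) : ∑ j, p j * w j ∈ Icc (0 : ℝ) 1 :=
  ⟨Finset.sum_nonneg fun j _ => mul_nonneg (hp j) (hw j).1,
    (Finset.sum_le_sum fun j _ => mul_le_of_le_one_right (hp j) (hw j).2).trans hp_sum.le⟩

theorem integral_prod_pow_of_batchPGF {Ω : Type*} [MeasurableSpace Ω] {μ : Measure Ω} {J : ℕ}
    {S : ℕ → Fin J → Ω → ℕ} {p : Fin J → ℝ} (hp : ∀ j, 0 ≤ p j) (hp_sum : ∑ j, p j = 1)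
    {ρ : ℝ} (hρ₀ : 0 < ρ) (hρ₁ : ρ < 1) {i : ℕ} {w : Fin J → ℝ} (hw : ∀ j, w j ∈ Icc (0 : ℝ) 1)
    (hS : batchPGF μ S i (fun j => (w j : ℂ)) = logPGF ρ (∑ j, (p j : ℂ) * (w j : ℂ))) :
    ∫ ω, ∏ j, w j ^ S i j ω ∂μ = Real.log (1 - ρ * ∑ j, p j * w j) / Real.log (1 - ρ) := by
  have h1 : (∑ j, (p j : ℂ) * (w j : ℂ)) = ((∑ j, p j * w j : ℝ) : ℂ) := by push_cast; rfl
  rw [h1, logPGF_ofReal hρ₀ hρ₁ (sum_mul_mem_Icc hp hp_sum hw), batchPGF] at hS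
  have h2 : ∀ ω, ∏ j, (w j : ℂ) ^ S i j ω = ((∏ j, w j ^ S i j ω : ℝ) : ℂ) := by
    intro ω; push_cast; rfl
  simp_rw [h2] at hS
  rw [integral_complex_ofReal] at hS
  exact_mod_cast hS

theorem sum_mul_routeMean {J : ℕ} {p : Fin J → ℝ} (hp_sum : ∑ j, p j = 1)
    (q : Fin J → Fin J → ℝ → ℝ) (z : Fin J → ℝ) (s : ℝ) :
    ∑ j, p j * routeMean q z j s =
      1 - ∑ k, mixedProb p q k s + ∑ k, mixedProb p q k s * z k := by
  have h1 : ∑ j, p j * ∑ k, (1 - z k) * q j k s = ∑ k, (1 - z k) * mixedProb p q k s := by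
    simp_rw [mixedProb, Finset.mul_sum]
    rw [Finset.sum_comm]
    exact Finset.sum_congr rfl fun k _ => Finset.sum_congr rfl fun j _ => by ring
  simp_rw [routeMean, mul_sub, mul_one]
  rw [Finset.sum_sub_distrib, hp_sum, h1, sub_add, ← Finset.sum_sub_distrib]
  congr 1
  exact Finset.sum_congr rfl fun k _ => by ring

theorem logKernel_eq_mul_logJump {J : ℕ} (ρ : ℝ) (lam : ℝ → ℝ) (p : Fin J → ℝ)
    (q : Fin J → Fin J → ℝ → ℝ) (t : ℝ) {v : Fin J} {i : Fin J → ℕ} (hi₀ : i ≠ 0)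
    (hi : ∀ k, v < k → i k = 0) {τ : ℝ} (hτ : τ ≤ t) :
    logKernel ρ lam p q t v i τ =
      lam τ * logJump ρ (fun k => mixedProb p q k ((t - τ).toNNReal : ℝ)) i := by
  have hsum : ∑ k ∈ Finset.Iic v, i k = ∑ k, i k :=
    Finset.sum_subset (Finset.subset_univ _) fun k _ hk => hi k (by simpa using hk)
  have hprod : ∏ k ∈ Finset.Iic v, mixedProb p q k (t - τ) ^ i k / ((i k)! : ℝ) =
      ∏ k, mixedProb p q k (t - τ) ^ i k / ((i k)! : ℝ) :=
    Finset.prod_subset (Finset.subset_univ _) fun k _ hk => by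
      rw [hi k (by simpa using hk)]; simp
  rw [logKernel, hsum, hprod, logJump, if_neg hi₀, Real.coe_toNNReal _ (sub_nonneg.mpr hτ)]
  ring

namespace IsNetwork

variable {Ω : Type*} [MeasurableSpace Ω] {μ : Measure Ω} {J : ℕ}
  {lam : ℝ → ℝ} {q : Fin J → Fin J → ℝ → ℝ} {T : ℕ → Ω → ℝ≥0∞} {S : ℕ → Fin J → Ω → ℕ}
  {X : ℕ → Fin J → ℕ → ℝ≥0 → Ω → Option (Fin J)} {p : Fin J → ℝ} {ρ : ℝ}

theorem mixedProb_nonneg (h : IsNetwork μ lam q T S X) (hp : ∀ j, 0 ≤ p j) (k : Fin J) (s : ℝ≥0) :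
    0 ≤ mixedProb p q k s :=
  Finset.sum_nonneg fun j _ => mul_nonneg (hp j) (h.route_law 0 j 0 s k ▸ measureReal_nonneg)

theorem hasSum_logJump_mixedProb (h : IsNetwork μ lam q T S X) (hp : ∀ j, 0 ≤ p j)
    (hp_sum : ∑ j, p j = 1) (hρ₀ : 0 < ρ) (hρ₁ : ρ < 1) {z : Fin J → ℝ}
    (hz : ∀ k, z k ∈ Icc (0 : ℝ) 1) (t τ : ℝ) :
    HasSum (fun i : Fin J → ℕ =>
        logJump ρ (fun k => mixedProb p q k ((t - τ).toNNReal : ℝ)) i * ∏ k, z k ^ i k)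
      (batchMean ρ p q t z τ - batchMean ρ p q t 0 τ) := by
  have h1 := hasSum_logJump hρ₀ hρ₁ (fun k => h.mixedProb_nonneg hp k (t - τ).toNNReal) hz
  rw [batchMean, batchMean, sum_mul_routeMean hp_sum, sum_mul_routeMean hp_sum]
  simpa using h1

theorem hasSum_logJump_mixedProb_one (h : IsNetwork μ lam q T S X) (hp : ∀ j, 0 ≤ p j)
    (hp_sum : ∑ j, p j = 1) (hρ₀ : 0 < ρ) (hρ₁ : ρ < 1) (t τ : ℝ) :
    HasSum (fun i : Fin J → ℕ => logJump ρ (fun k => mixedProb p q k ((t - τ).toNNReal : ℝ)) i)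
      (batchMean ρ p q t (fun _ => 1) τ - batchMean ρ p q t 0 τ) := by
  simpa using h.hasSum_logJump_mixedProb hp hp_sum hρ₀ hρ₁ (z := fun _ => 1) (fun _ => by simp) t τ

/-- The rate at which the batches arriving in `[0, t)` contribute the vector `i` to the numbers of
customers at time `t`. -/
noncomputable def jumpRate (lam : ℝ → ℝ) (p : Fin J → ℝ) (q : Fin J → Fin J → ℝ → ℝ) (ρ t : ℝ) :
    MvPowerSeries (Fin J) ℝ := fun i =>
  ∫ τ in Ico 0 t, logJump ρ (fun k => mixedProb p q k ((t - τ).toNNReal : ℝ)) i ∂(intensity lam)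

theorem coeff_jumpRate (lam : ℝ → ℝ) (p : Fin J → ℝ) (q : Fin J → Fin J → ℝ → ℝ) (ρ t : ℝ)
    (i : Fin J →₀ ℕ) : MvPowerSeries.coeff i (jumpRate lam p q ρ t) = ∫ τ in Ico 0 t,
      logJump ρ (fun k => mixedProb p q k ((t - τ).toNNReal : ℝ)) i ∂(intensity lam) := rfl

theorem coeff_jumpRate_nonneg (h : IsNetwork μ lam q T S X) (hp : ∀ j, 0 ≤ p j) (hρ₀ : 0 < ρ)
    (hρ₁ : ρ < 1) (t : ℝ) (i : Fin J →₀ ℕ) :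
    0 ≤ MvPowerSeries.coeff i (jumpRate lam p q ρ t) :=
  integral_nonneg fun _ => logJump_nonneg hρ₀ hρ₁ (fun k => h.mixedProb_nonneg hp k _) _

variable [IsProbabilityMeasure μ]

theorem measurable_mixedProb (h : IsNetwork μ lam q T S X) (k : Fin J) :
    Measurable fun s : ℝ≥0 => mixedProb p q k s :=
  Finset.measurable_sum _ fun j _ => (h.measurable_routeProb j k).const_mul _

theorem measurable_logJump_mixedProb (h : IsNetwork μ lam q T S X) (t : ℝ) (i : Fin J → ℕ) :
    Measurable fun τ : ℝ => logJump ρ (fun k => mixedProb p q k ((t - τ).toNNReal : ℝ)) i :=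
  (measurable_logJump ρ i).comp (measurable_pi_iff.mpr fun k => (h.measurable_mixedProb k).comp
    (measurable_const.sub measurable_id).real_toNNReal)

theorem batchMean_mem_Icc (h : IsNetwork μ lam q T S X) (hp : ∀ j, 0 ≤ p j)
    (hp_sum : ∑ j, p j = 1) (hρ₀ : 0 < ρ) (hρ₁ : ρ < 1) {z : Fin J → ℝ}
    (hz : ∀ k, z k ∈ Icc (0 : ℝ) 1) (t τ : ℝ) : batchMean ρ p q t z τ ∈ Icc (0 : ℝ) 1 :=
  log_div_mem_Icc hρ₀ hρ₁ (sum_mul_mem_Icc hp hp_sum fun j => h.routeMean_mem_Icc hz j _)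

theorem measurable_batchMean (h : IsNetwork μ lam q T S X) (z : Fin J → ℝ) (t : ℝ) :
    Measurable (batchMean ρ p q t z) := by
  unfold batchMean
  have h1 : ∀ j, Measurable fun τ : ℝ => routeMean q z j ((t - τ).toNNReal : ℝ) := fun j =>
    (h.measurable_routeMean j).comp (measurable_const.sub measurable_id).real_toNNReal
  fun_prop

theorem logJump_mixedProb_le_one (h : IsNetwork μ lam q T S X) (hp : ∀ j, 0 ≤ p j)
    (hp_sum : ∑ j, p j = 1) (hρ₀ : 0 < ρ) (hρ₁ : ρ < 1) (t τ : ℝ) (i : Fin J → ℕ) :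
    logJump ρ (fun k => mixedProb p q k ((t - τ).toNNReal : ℝ)) i ≤ 1 := by
  have h1 := le_hasSum (h.hasSum_logJump_mixedProb_one hp hp_sum hρ₀ hρ₁ t τ) i
    fun j _ => logJump_nonneg hρ₀ hρ₁ (fun k => h.mixedProb_nonneg hp k _) _
  have h2 := h.batchMean_mem_Icc hp hp_sum hρ₀ hρ₁ (z := fun _ => 1) (fun _ => by simp) t τ
  have h3 := h.batchMean_mem_Icc hp hp_sum hρ₀ hρ₁ (z := 0) (fun _ => by simp) t τ
  linarith [h2.2, h3.1]

theorem integrable_batchMean (h : IsNetwork μ lam q T S X)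
    (hlam : LocallyIntegrableOn lam (Ici 0)) (hp : ∀ j, 0 ≤ p j)
    (hp_sum : ∑ j, p j = 1) (hρ₀ : 0 < ρ) (hρ₁ : ρ < 1) {z : Fin J → ℝ}
    (hz : ∀ k, z k ∈ Icc (0 : ℝ) 1) (t : ℝ) :
    Integrable (batchMean ρ p q t z) ((intensity lam).restrict (Ico 0 t)) := by
  have : IsFiniteMeasure ((intensity lam).restrict (Ico 0 t)) :=
    ⟨by simpa using (intensity_Ico_ne_top hlam t).lt_top⟩
  refine Integrable.of_bound (h.measurable_batchMean z t).aestronglyMeasurable 1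
    (ae_of_all _ fun τ => ?_)
  have := h.batchMean_mem_Icc hp hp_sum hρ₀ hρ₁ hz t τ
  rw [Real.norm_eq_abs, abs_of_nonneg this.1]
  exact this.2

theorem hasSum_jumpRate (h : IsNetwork μ lam q T S X) (hlam : LocallyIntegrableOn lam (Ici 0))
    (hp : ∀ j, 0 ≤ p j) (hp_sum : ∑ j, p j = 1) (hρ₀ : 0 < ρ) (hρ₁ : ρ < 1) (t : ℝ)
    {z : Fin J → ℝ} (hz : ∀ k, z k ∈ Icc (0 : ℝ) 1) :
    HasSum (fun i : Fin J →₀ ℕ =>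
        MvPowerSeries.coeff i (jumpRate lam p q ρ t) * ∏ k, z k ^ i k)
      (∫ τ in Ico 0 t, (batchMean ρ p q t z τ - batchMean ρ p q t 0 τ) ∂(intensity lam)) := by
  let F : (Fin J → ℕ) → ℝ → ℝ := fun i τ =>
    logJump ρ (fun k => mixedProb p q k ((t - τ).toNNReal : ℝ)) i
  have hF : ∀ i, Measurable (F i) := h.measurable_logJump_mixedProb t
  have hF₀ : ∀ i τ, 0 ≤ F i τ := fun i τ =>
    logJump_nonneg hρ₀ hρ₁ (fun k => h.mixedProb_nonneg hp k _) _
  have hs : ∀ τ, HasSum (fun i => F i τ) _ := h.hasSum_logJump_mixedProb_one hp hp_sum hρ₀ hρ₁ t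
  have hint : Integrable (fun τ => ∑' i, F i τ) ((intensity lam).restrict (Ico 0 t)) := by
    simp_rw [fun τ => (hs τ).tsum_eq]
    exact (h.integrable_batchMean hlam hp hp_sum hρ₀ hρ₁ (fun _ => by simp) t).sub
      (h.integrable_batchMean hlam hp hp_sum hρ₀ hρ₁ (fun _ => by simp) t)
  have h1 := hasSum_integral_of_dominated_convergence
    (μ := (intensity lam).restrict (Ico 0 t)) (F := fun i τ => F i τ * ∏ k, z k ^ i k) F
    (fun i => ((hF i).mul_const _).aestronglyMeasurable)
    (fun i => ae_of_all _ fun τ => by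
      rw [Real.norm_eq_abs, abs_of_nonneg (mul_nonneg (hF₀ i τ) (prod_pow_mem_Icc hz i).1)]
      exact mul_le_of_le_one_right (hF₀ i τ) (prod_pow_mem_Icc hz i).2)
    (ae_of_all _ fun τ => (hs τ).summable) hint
    (ae_of_all _ fun τ => h.hasSum_logJump_mixedProb hp hp_sum hρ₀ hρ₁ hz t τ)
  simp_rw [integral_mul_const] at h1
  simp_rw [coeff_jumpRate]
  exact hasSum_finsupp_of_hasSum_pi h1

/-- The vector of the numbers of customers has a compound Poisson distribution. -/
theorem occupancyProb_eq_compoundPoisson (h : IsNetwork μ lam q T S X)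
    (hlam : LocallyIntegrableOn lam (Ici 0)) (hp : ∀ j, 0 ≤ p j) (hp_sum : ∑ j, p j = 1)
    (hρ₀ : 0 < ρ) (hρ₁ : ρ < 1)
    (hS : ∀ (i : ℕ) (z : Fin J → ℂ), (∀ j, ‖z j‖ ≤ 1) →
      batchPGF μ S i z = logPGF ρ (∑ j, (p j : ℂ) * z j)) (t : ℝ≥0) (n : Fin J →₀ ℕ) :
    occupancyProb μ T S X t n = compoundPoisson (jumpRate lam p q ρ t) n := by
  have hc := h.coeff_jumpRate_nonneg hp hρ₀ hρ₁ t
  have hg : Measurable fun w : Fin J → ℝ =>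
      Real.log (1 - ρ * ∑ j, p j * w j) / Real.log (1 - ρ) := by fun_prop
  have hone : ∀ τ, batchMean ρ p q t (fun _ => 1) τ = 1 := by
    intro τ
    have hL : Real.log (1 - ρ) ≠ 0 := (Real.log_neg (by linarith) (by linarith)).ne
    simp only [batchMean, routeMean, sub_self, zero_mul, Finset.sum_const_zero, sub_zero, mul_one,
      hp_sum]
    exact div_self hL
  have hW := fun z hz => h.integrable_batchMean (z := z) hlam hp hp_sum hρ₀ hρ₁ hz t
  have hH := fun z hz => h.hasSum_jumpRate (z := z) hlam hp hp_sum hρ₀ hρ₁ t hz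
  have htot := (hH (fun _ => 1) (fun _ => by simp)).tsum_eq
  simp only [one_pow, Finset.prod_const_one, mul_one] at htot
  have hpgf : ∀ z : Fin J → ℝ, (∀ k, z k ∈ Icc (0 : ℝ) 1) →
      HasSum (fun n : Fin J → ℕ =>
        (occupancyProb μ T S X t n - compoundPoisson (jumpRate lam p q ρ t)
          (Finsupp.equivFunOnFinite.symm n)) * ∏ k, z k ^ n k) 0 := by
    intro z hz
    have h1 := h.hasSum_occupancyProb hlam t hz
    have h2 := h.integral_prod_pow_occupancyVec hlam t hz hg
      (fun w hw => log_div_mem_Icc hρ₀ hρ₁ (sum_mul_mem_Icc hp hp_sum hw))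
      fun i w hw => integral_prod_pow_of_batchPGF hp hp_sum hρ₀ hρ₁ hw (hS i _ fun j => by
        rw [Complex.norm_real, Real.norm_eq_abs, abs_of_nonneg (hw j).1]; exact (hw j).2)
    have h3 := (Finsupp.equivFunOnFinite : (Fin J →₀ ℕ) ≃ (Fin J → ℕ)).symm.hasSum_iff.mpr
      (hasSum_compoundPoisson hc (fun k => (hz k).1) (hH z hz))
    have hexp : (∫ τ in Ico (0 : ℝ) t, (batchMean ρ p q t z τ - 1) ∂(intensity lam)) =
        (∫ τ in Ico (0 : ℝ) t, (batchMean ρ p q t z τ - batchMean ρ p q t 0 τ) ∂(intensity lam)) -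
          ∑' i : Fin J →₀ ℕ, MvPowerSeries.coeff i (jumpRate lam p q ρ t) := by
      have h0 := hW 0 fun _ => by simp
      have h5 := hW (fun _ => 1) fun _ => by simp
      have h6 := integral_sub ((hW z hz).sub h0) (h5.sub h0)
      simp only [Pi.sub_apply] at h6
      rw [htot, ← h6]
      refine integral_congr_ae (ae_of_all _ fun τ => ?_)
      simp only [hone]; ring
    rw [h2.trans (congrArg Real.exp hexp)] at h1
    have h4 := h1.sub h3
    rw [sub_self] at h4
    refine (congrArg (fun f => HasSum f _ _) (funext fun n => ?_)).mpr h4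
    rw [sub_mul]; rfl
  have hsum := (hpgf (fun _ => 1) fun _ => by simp).summable
  simp only [one_pow, Finset.prod_const_one, mul_one] at hsum
  have := eq_zero_of_tsum_monomial_eq_zero hsum (fun z hz => (hpgf z hz).tsum_eq) n
  rw [sub_eq_zero] at this
  rw [this]
  congr 1
  exact Finsupp.equivFunOnFinite.symm_apply_apply n

end IsNetwork
end LogBatches

namespace IsNetwork

variable {Ω : Type*} [MeasurableSpace Ω] {μ : Measure Ω} [IsProbabilityMeasure μ] {J : ℕ}
  {lam : ℝ → ℝ} {q : Fin J → Fin J → ℝ → ℝ} {T : ℕ → Ω → ℝ≥0∞} {S : ℕ → Fin J → Ω → ℕ}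
  {X : ℕ → Fin J → ℕ → ℝ≥0 → Ω → Option (Fin J)} {p : Fin J → ℝ} {ρ : ℝ}

theorem intervalIntegrable_logKernel (h : IsNetwork μ lam q T S X)
    (hlam : LocallyIntegrableOn lam (Ici 0)) (hp : ∀ j, 0 ≤ p j) (hp_sum : ∑ j, p j = 1)
    (hρ₀ : 0 < ρ) (hρ₁ : ρ < 1) (t : ℝ≥0) {v : Fin J} {i : Fin J → ℕ} (hi₀ : i ≠ 0)
    (hi : ∀ k, v < k → i k = 0) :
    IntervalIntegrable (logKernel ρ lam p q t v i) volume 0 t := by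
  rw [intervalIntegrable_iff_integrableOn_Icc_of_le t.coe_nonneg]
  have h1 : IntegrableOn (fun τ => lam τ *
      logJump ρ (fun k => mixedProb p q k ((t - τ).toNNReal : ℝ)) i) (Icc 0 (t : ℝ)) := by
    refine Integrable.mul_bdd (c := 1) (locallyIntegrableOn_integrableOn_Icc hlam t)
      (h.measurable_logJump_mixedProb t i).aestronglyMeasurable (ae_of_all _ fun τ => ?_)
    rw [Real.norm_eq_abs,
      abs_of_nonneg (logJump_nonneg hρ₀ hρ₁ (fun k => h.mixedProb_nonneg hp k _) _)]
    exact h.logJump_mixedProb_le_one hp hp_sum hρ₀ hρ₁ t τ i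
  exact h1.congr_fun (fun τ hτ => (logKernel_eq_mul_logJump ρ lam p q t hi₀ hi hτ.2).symm)
    measurableSet_Icc

theorem coeff_jumpRate_eq_integral_logKernel (hlam_nonneg : ∀ τ, 0 ≤ τ → 0 ≤ lam τ)
    (hlam : LocallyIntegrableOn lam (Ici 0)) (t : ℝ≥0) {v : Fin J} {i : Fin J →₀ ℕ}
    (hi₀ : i ≠ 0) (hi : ∀ k, v < k → i k = 0) :
    MvPowerSeries.coeff i (jumpRate lam p q ρ t) =
      ∫ τ in (0 : ℝ)..t, logKernel ρ lam p q t v i τ := by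
  rw [coeff_jumpRate, setIntegral_intensity hlam_nonneg hlam t.coe_nonneg]
  refine intervalIntegral.integral_congr fun τ hτ => ?_
  rw [uIcc_of_le t.coe_nonneg] at hτ
  exact (logKernel_eq_mul_logJump ρ lam p q t (fun h => hi₀ (DFunLike.coe_injective h)) hi hτ.2).symm

end IsNetwork
end BatchQueue

/-- Queues are indexed from `0`, so the queues `2, …, J` are the `v : Fin J` with `1 ≤ v`. -/
theorem corollary5p5 {Ω : Type*} [MeasurableSpace Ω] (μ : Measure Ω) [IsProbabilityMeasure μ]
    {J : ℕ} (lam : ℝ → ℝ) (q : Fin J → Fin J → ℝ → ℝ) (T : ℕ → Ω → ℝ≥0∞)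
    (S : ℕ → Fin J → Ω → ℕ) (X : ℕ → Fin J → ℕ → ℝ≥0 → Ω → Option (Fin J))
    (hlam_nonneg : ∀ τ, 0 ≤ τ → 0 ≤ lam τ) (hlam : LocallyIntegrableOn lam (Ici 0))
    (hnet : BatchQueue.IsNetwork μ lam q T S X)
    (p : Fin J → ℝ) (hp : ∀ j, 0 ≤ p j) (hp_sum : ∑ j, p j = 1)
    (ρ : ℝ) (hρ₀ : 0 < ρ) (hρ₁ : ρ < 1)
    (hS : ∀ (i : ℕ) (z : Fin J → ℂ), (∀ j, ‖z j‖ ≤ 1) →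
      BatchQueue.batchPGF μ S i z = BatchQueue.logPGF ρ (∑ j, (p j : ℂ) * z j))
    (t : ℝ≥0) (v : Fin J) (hv : 1 ≤ (v : ℕ)) (n : Fin J → ℕ) (hnv : 1 ≤ n v)
    (hn : ∀ k, v < k → n k = 0) :
    (∀ i : Fin J → ℕ, i ≤ n → 1 ≤ i v →
      IntervalIntegrable (BatchQueue.logKernel ρ lam p q t v i) volume 0 t) ∧
    BatchQueue.occupancyProb μ T S X t n =
      ∑ i ∈ Finset.Iic n with 1 ≤ i v,
        (i v : ℝ) / (n v : ℝ) * BatchQueue.occupancyProb μ T S X t (n - i) *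
          ∫ τ in (0 : ℝ)..t, BatchQueue.logKernel ρ lam p q t v i τ := by
  have hne : ∀ i : Fin J → ℕ, 1 ≤ i v → i ≠ 0 := by
    rintro i hi rfl
    simp at hi
  have hvan : ∀ i : Fin J → ℕ, i ≤ n → ∀ k, v < k → i k = 0 := fun i hi k hk =>
    Nat.le_zero.mp ((hi k).trans (hn k hk).le)
  refine ⟨fun i hi hiv => hnet.intervalIntegrable_logKernel hlam hp hp_sum hρ₀ hρ₁ t
    (hne i hiv) (hvan i hi), ?_⟩
  let e : (Fin J →₀ ℕ) ≃ (Fin J → ℕ) := Finsupp.equivFunOnFinite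
  have hP : ∀ m : Fin J →₀ ℕ, BatchQueue.occupancyProb μ T S X t m =
      BatchQueue.compoundPoisson (BatchQueue.IsNetwork.jumpRate lam p q ρ t) m :=
    hnet.occupancyProb_eq_compoundPoisson hlam hp hp_sum hρ₀ hρ₁ hS t
  have hsum := (hnet.hasSum_jumpRate hlam hp hp_sum hρ₀ hρ₁ t (z := fun _ => 1)
    fun _ => by simp).summable
  simp only [one_pow, Finset.prod_const_one, mul_one] at hsum
  have hrec := BatchQueue.compoundPoisson_recurrence (hnet.coeff_jumpRate_nonneg hp hρ₀ hρ₁ t)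
    hsum v (e.symm n)
  have hnv' : (n v : ℝ) ≠ 0 := by positivity
  have hcoe : ∀ i : Fin J → ℕ, ⇑(e.symm i) = i := fun i => e.apply_symm_apply i
  rw [← hP, hcoe, mul_comm, ← eq_div_iff hnv', Finset.sum_div] at hrec
  rw [hrec]
  symm
  refine Finset.sum_bij_ne_zero (fun i _ _ => (e.symm i, e.symm (n - i))) ?_ ?_ ?_ ?_
  · intro i hi _
    rw [Finset.mem_filter, Finset.mem_Iic] at hi
    rw [Finset.HasAntidiagonal.mem_antidiagonal]
    refine DFunLike.coe_injective ?_
    rw [Finsupp.coe_add, hcoe, hcoe, hcoe]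
    exact add_tsub_cancel_of_le hi.1
  · intro i _ _ i' _ _ hii
    exact e.symm.injective (Prod.ext_iff.mp hii).1
  · rintro ⟨a, b⟩ hab hne0
    rw [Finset.HasAntidiagonal.mem_antidiagonal] at hab
    have hab' : (a : Fin J → ℕ) + b = n := by
      rw [← Finsupp.coe_add, hab, hcoe]
    have hav : 1 ≤ a v := by
      by_contra h0
      exact hne0 (by simp [show a v = 0 by omega])
    have ha : (a : Fin J → ℕ) ≤ n := by rw [← hab']; exact le_self_add
    have hbn : n - (a : Fin J → ℕ) = b := by rw [← hab']; exact add_tsub_cancel_left _ _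
    refine ⟨a, by simp [ha, hav], ?_, ?_⟩
    · rw [hbn, hP, ← BatchQueue.IsNetwork.coeff_jumpRate_eq_integral_logKernel hlam_nonneg hlam t
        (fun h0 => hne a hav (by rw [h0]; rfl)) (hvan a ha)]
      convert hne0 using 1
      ring
    · rw [hbn]
      exact Prod.ext (e.symm_apply_apply a) (e.symm_apply_apply b)
  · intro i hi _
    rw [Finset.mem_filter, Finset.mem_Iic] at hi
    have hi0 : e.symm i ≠ 0 := fun h0 => hne i hi.2 (by rw [← hcoe i, h0]; rfl)
    have hint := BatchQueue.IsNetwork.coeff_jumpRate_eq_integral_logKernel (p := p) (q := q) (ρ := ρ)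
      hlam_nonneg hlam t hi0 (v := v) (by rw [hcoe]; exact hvan i hi.1)
    rw [hcoe] at hint
    rw [← hP, hint, hcoe, hcoe]
    ring
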